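/- Fix $\omega\in\{1,-1\}$. **Trees.** A *tree* is a finite partially ordered set $T$ (whose elements are called nodes) such that: (1) if $v_4\le v_2\le v_1$ and $v_4\le v_3\le v_1$, then $v_2\le v_3$ or $v_3\le v_2$; (2) there is a (unique) element $v_0$, the root, with $v\le v_0$ for all $v\in T$; (3) each $v\in T$ has either no children or exactly three children, labelled $(v,1),(v,2),(v,3)$, where $w$ is a child of $v$ if $w<v$ and no $u$ satisfies $w<u<v$; (4) each $v\in T$ carries a sign $\pm_v\in\{1,-1\}$. Let $T^\infty$ be the set of nodes without children (terminal nodes) and $T^0=T\setminus T^\infty$. An *ornamented tree* is a tree together with a partition of $T^0$ into simple nodes and general nodes, and a coefficient $\varepsilon_{v,i}\in\{-1,0,1\}$ for each $v\in T^0$ and $i\in\{1,2,3\}$ with $(v,i)\in T^0$. **Indices.** Let $\mathcal J(T)$ be the set of $\mathbf j=(j_v)_{v\in T}\in\mathbb Z^T$ such that - $j_v=j_{(v,1)}-j_{(v,2)}+j_{(v,3)}$ for every $v\in T^0$; - $\{j_v,j_{(v,2)}\}\cap\{j_{(v,1)},j_{(v,3)}\}=\emptyset$ for every general node $v$; - $j_v=j_{(v,i)}$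 for $i=1,2,3$ for every simple node $v$. For $v\in T^0$ put $\sigma_v(\mathbf j)=j_v^2-j_{(v,1)}^2+j_{(v,2)}^2-j_{(v,3)}^2$. **Tree operators.** For $t\ge 0$ let $\mathcal R(T,t)$ be the set of $(t_u)_{u\in T^0}\in\mathbb R^{T^0}$ with $0\le t_u\le t_{u'}\le t$ whenever $u\le u'$, and $$\mathcal I_T(t,\mathbf j)=\int_{\mathcal R(T,t)}\prod_{u\in T^0}e^{\pm_u i\omega\sigma_u(\mathbf j)t_u}\,dt_u .$$ For complex sequences $x_v=(x_v(n))_{n\in\mathbb Z}$, $v\in T^\infty$, put $$\mathcal S_T(t)(x_v)_{v\in T^\infty}(n)=\sum_{\mathbf j\in\mathcal J(T):\,j_{v_0}=n}\mathcal I_T(t,\mathbf j)\prod_{w\in T^\infty}x_w(j_w).$$ **Proposition.** Let $p\in(1,\infty)$ and $q\in[1,\infty]$. There exist $\varepsilon>0$ and $C<\infty$ such that for all ornamented trees $T$ with more than one node and with $q>p/|T^\infty|$, all $t\in[0,1]$, and all sequences $x_v\in\ell^1(\mathbb Z)$ $(v\in T^\infty)$, the series defining $\mathcal S_T(t)(x_v)_{v\in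 T^\infty}(n)$ converges absolutely for every $n\in\mathbb Z$, and $$\big\|\mathcal S_T(t)(x_v)_{v\in T^\infty}\big\|_{\ell^q}\le (Ct^{\varepsilon})^{|T^\infty|}\prod_{v\in T^\infty}\|x_v\|_{\ell^p}.$$ -/

import Mathlib

open MeasureTheory

/-- The non-terminal nodes of a finite partially ordered set of nodes: those having at least one
child, where `w` is a child of `v` if `w < v` with nothing strictly between (`w ⋖ v`). -/
def NonterminalNode (V : Type*) [PartialOrder V] : Type _ := {v : V // ∃ w, w ⋖ v}

/-- The terminal nodes: those with no child. -/
def TerminalNode (V : Type*) [PartialOrder V] : Type _ := {v : V // ∀ w, ¬ w ⋖ v}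

noncomputable instance {V : Type*} [PartialOrder V] [Finite V] : Fintype (NonterminalNode V) :=
  have : Finite (NonterminalNode V) := inferInstanceAs (Finite {v : V // ∃ w, w ⋖ v})
  Fintype.ofFinite _

noncomputable instance {V : Type*} [PartialOrder V] [Finite V] : Fintype (TerminalNode V) :=
  have : Finite (TerminalNode V) := inferInstanceAs (Finite {v : V // ∀ w, ¬ w ⋖ v})
  Fintype.ofFinite _

/-- The structure of a (signed, ternary) tree on a partially ordered set `V` of nodes, which is
taken finite wherever it is used. -/
structure TernaryTree (V : Type*) [PartialOrder V] where
  le_total_of_between : ∀ v₁ v₂ v₃ v₄ : V,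
    v₄ ≤ v₂ → v₂ ≤ v₁ → v₄ ≤ v₃ → v₃ ≤ v₁ → v₂ ≤ v₃ ∨ v₃ ≤ v₂
  /-- The root (unique by antisymmetry). -/
  root : V
  le_root : ∀ v, v ≤ root
  /-- The children of a non-terminal node, in order: `child v 0`, `child v 1`, `child v 2` are the
  first, second and third child. -/
  child : NonterminalNode V → Fin 3 → V
  /-- The three listed children are distinct ... -/
  child_injective : ∀ v, Function.Injective (child v)
  /-- ... and they are all the children, so each node has either three children or none. -/
  range_child : ∀ v, Set.range (child v) = {w | w ⋖ v.1}
  /-- The sign attached to each node. -/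
  sign : V → ℤˣ

/-- An ornamented tree: the non-terminal nodes are divided into simple nodes and general nodes
(those not simple), and each pair `(v, i)` has a coefficient in `{-1, 0, 1}`. The coefficient is
meaningful only if the `i`-th child of `v` is non-terminal. -/
structure OrnamentedTree (V : Type*) [PartialOrder V] extends TernaryTree V where
  simple : Set (NonterminalNode V)
  coeff : NonterminalNode V → Fin 3 → SignType

/-- `σ(j,k,l,n) = n² - j² + k² - l²`. -/
def resonance (j k l n : ℤ) : ℤ := n ^ 2 - j ^ 2 + k ^ 2 - l ^ 2

namespace TernaryTree

variable {V : Type*} [PartialOrder V]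

/-- `σ_w(𝐣)` at a non-terminal node `w`. -/
def nodeResonance (T : TernaryTree V) (j : V → ℤ) (w : NonterminalNode V) : ℤ :=
  resonance (j (T.child w 0)) (j (T.child w 1)) (j (T.child w 2)) (j w.1)

/-- The region of times `(t_u)`, indexed by the non-terminal nodes, such that
`0 ≤ t_u ≤ t_{u'} ≤ t` whenever `u ≤ u'`. -/
def timeRegion (_T : TernaryTree V) (t : ℝ) : Set (NonterminalNode V → ℝ) :=
  {s | ∀ u u' : NonterminalNode V, u.1 ≤ u'.1 → 0 ≤ s u ∧ s u ≤ s u' ∧ s u' ≤ t}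

/-- The tree coefficient `I_T(t, 𝐣)`. If there is no non-terminal node, the integral is over a
one-point space of mass one. -/
noncomputable def treeCoeff [Finite V] (T : TernaryTree V) (ω t : ℝ) (j : V → ℤ) : ℂ :=
  ∫ s in T.timeRegion t, ∏ u : NonterminalNode V,
    Complex.exp (((T.sign u.1 : ℤ) : ℂ) * Complex.I * (ω : ℂ) * (T.nodeResonance j u : ℂ) *
      (s u : ℂ))

end TernaryTree

namespace OrnamentedTree

variable {V : Type*} [PartialOrder V]

/-- The set `𝓙(T)` of admissible index vectors `𝐣 = (j_v)`. -/
def indexSet (T : OrnamentedTree V) : Set (V → ℤ) :=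
  {j | (∀ v : NonterminalNode V,
          j v.1 = j (T.child v 0) - j (T.child v 1) + j (T.child v 2)) ∧
       (∀ v : NonterminalNode V, v ∉ T.simple →
          ({j v.1, j (T.child v 1)} ∩ {j (T.child v 0), j (T.child v 2)} : Set ℤ) = ∅) ∧
       (∀ v : NonterminalNode V, v ∈ T.simple → ∀ i : Fin 3, j v.1 = j (T.child v i))}

/-- The term with index `𝐣` in the series defining the tree operator. -/
noncomputable def treeTerm [Finite V] (T : OrnamentedTree V) (ω t : ℝ)
    (x : TerminalNode V → ℤ → ℂ) (j : V → ℤ) : ℂ :=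
  T.treeCoeff ω t j * ∏ w : TerminalNode V, x w (j w.1)

/-- The tree operator `S_T(t)` applied to the sequences `(x_w)`. -/
noncomputable def treeOperator [Finite V] (T : OrnamentedTree V) (ω t : ℝ)
    (x : TerminalNode V → ℤ → ℂ) (n : ℤ) : ℂ :=
  ∑' j : {j : V → ℤ // j ∈ T.indexSet ∧ j T.root = n}, T.treeTerm ω t x j.1

end OrnamentedTree

/-- The `ℓ^p` norm, with values in `[0, ∞]`, of a sequence of complex numbers indexed by `ℤ`. -/
noncomputable def ellNorm (p : ENNReal) (x : ℤ → ℂ) : ENNReal :=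
  eLpNorm x p Measure.count

/-! The heart of the matter is a bound on the kernel: for every `R > 1`, the sum of `|I_T(t, j)| ^
R` over admissible `j` with one index fixed, at the root or at a leaf, is at most `(C t ^ η) ^ m`,
where `m` is the number of non-terminal nodes and `C`, `η` do not depend on the tree
(`tsum_treeCoeff_rpow_le`).

Since all phases are integers, `I_T(t, j)` has on `[0, 1]` an absolutely convergent Fourier series
with integer frequencies `τ`. Its coefficients are built recursively: by Fubini, the coefficient of
a tree is the integral over the root time of an exponential times the coefficients of the three
branches, and integration in time multiplies by a kernel of size `⟨ρ⟩⁻¹`, where `ρ` is the total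
frequency at the node and `⟨ρ⟩ = 1 + |ρ|`. The exponent `-1` just fails to be summable. Hölder's
inequality therefore bounds the coefficients by `w ^ (1 - 1/s) * b ^ (1/s)` with `s > 1`: `w`
carries no decay and is summed over `τ` for each `j`, while `b` carries `⟨ρ⟩ ^ (-s)` and is summed
over `j` as well (`TreeMajorant`).

At a general node the resonance is `2 (j_v - j_1)(j_v - j_3)` with both factors nonzero. With one
entry fixed, the sum over node indices is thus a sum over products of integers, and the divisor
bound makes it converge with a loss `⟨μ⟩ ^ ε`, which the excess `s - κ = ε` absorbs. Bounds for `b`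
with the root fixed and with a leaf fixed are propagated together by induction on the tree
(`tsum_node_root_le`, `tsum_node_leaf_le`, `exists_treeMajorant`). The power of `t` comes from the
trivial bound `|I_T| ≤ t ^ m`, applied to the part `R - s` of the exponent.

Finally, an admissible `j` is determined by its values at the leaves, which gives an `ℓ¹` endpoint.
Hölder's inequality combines it with the kernel bounds (`tsum_rpow_multilinear_le`); the exponent
`R` it needs stays away from `1` uniformly in the number of leaves
(`exists_interpolation_exponents`). -/

/-! ### The divisor bound. -/

/-- Factor over primes. A prime `q ≥ 2 ^ (1/ε)` has `q ^ ε ≥ 2`, so its factor `e + 1 ≤ 2 ^ e` is at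
most `q ^ (ε e)`. Each of the boundedly many smaller primes costs at most a constant `c`. -/
theorem card_divisors_le_rpow {ε : ℝ} (hε : 0 < ε) :
    ∃ D : ℝ, 0 < D ∧ ∀ n : ℕ, n ≠ 0 → (n.divisors.card : ℝ) ≤ D * (n : ℝ) ^ ε := by
  have h2 : (1 : ℝ) < 2 ^ ε := Real.one_lt_rpow (by norm_num) hε
  -- Chosen so that `e + 1 ≤ c (1 + e (2 ^ ε - 1))`, the right side being controlled by Bernoulli's
  -- inequality.
  set c : ℝ := 1 + 1 / (2 ^ ε - 1) with hc
  have hc1 : 1 ≤ c := by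
    have : 0 ≤ 1 / ((2 : ℝ) ^ ε - 1) := by
      apply div_nonneg <;> linarith
    linarith
  obtain ⟨K, hK⟩ := exists_nat_ge ((2 : ℝ) ^ (1 / ε))
  refine ⟨c ^ K, by positivity, fun n hn => ?_⟩
  have key : ∀ q ∈ n.primeFactors, ((n.factorization q + 1 : ℕ) : ℝ) ≤
      (if q < K then c else 1) * ((q : ℝ) ^ ε) ^ n.factorization q := by
    intro q hq
    have hq2 : (2 : ℝ) ≤ q := by exact_mod_cast (Nat.prime_of_mem_primeFactors hq).two_le
    set e := n.factorization q
    split_ifs with h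
    · have h1 : (2 : ℝ) ^ ε ≤ (q : ℝ) ^ ε := Real.rpow_le_rpow (by norm_num) hq2 hε.le
      have h3 : ((2 : ℝ) ^ ε) ^ e ≤ ((q : ℝ) ^ ε) ^ e := pow_le_pow_left₀ (by positivity) h1 _
      have h4 : 1 + (e : ℝ) * (2 ^ ε - 1) ≤ (2 ^ ε) ^ e := by
        have := one_add_mul_le_pow (a := (2 : ℝ) ^ ε - 1) (by linarith) e
        simpa using this
      have h5 : (e : ℝ) + 1 ≤ c * (1 + (e : ℝ) * (2 ^ ε - 1)) := by
        have h6 : c * (1 + (e : ℝ) * (2 ^ ε - 1)) =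
            1 + 1 / (2 ^ ε - 1) + e * (2 ^ ε - 1) + e := by
          rw [hc]; field_simp [show (2 : ℝ) ^ ε - 1 ≠ 0 by linarith]; ring
        have : 0 ≤ 1 / ((2 : ℝ) ^ ε - 1) := by apply div_nonneg <;> linarith
        have : 0 ≤ (e : ℝ) * (2 ^ ε - 1) := by
          apply mul_nonneg (by positivity); linarith
        linarith
      push_cast
      exact h5.trans (by gcongr; exact h4.trans h3)
    · have h1 : (2 : ℝ) ≤ (q : ℝ) ^ ε := by
        have h7 : (2 : ℝ) ^ (1 / ε) ≤ q := hK.trans (by exact_mod_cast not_lt.mp h)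
        calc (2 : ℝ) = ((2 : ℝ) ^ (1 / ε)) ^ ε := by
              rw [← Real.rpow_mul (by norm_num)]; field_simp; simp
          _ ≤ _ := Real.rpow_le_rpow (by positivity) h7 hε.le
      have h3 : (2 : ℝ) ^ e ≤ ((q : ℝ) ^ ε) ^ e := pow_le_pow_left₀ (by norm_num) h1 _
      have h8 : ((e + 1 : ℕ) : ℝ) ≤ 2 ^ e := by exact_mod_cast Nat.lt_two_pow_self
      rw [one_mul]; exact h8.trans h3
  rw [Nat.card_divisors hn]
  push_cast
  have h9 : ∏ q ∈ n.primeFactors, ((q : ℝ) ^ ε) ^ n.factorization q = (n : ℝ) ^ ε := by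
    conv_rhs => rw [← Nat.prod_factorization_pow_eq_self hn]
    rw [Finsupp.prod, Nat.support_factorization]
    push_cast
    rw [← Real.finsetProd_rpow _ _ (fun i _ => by positivity)]
    refine Finset.prod_congr rfl fun q _ => ?_
    rw [← Real.rpow_natCast, ← Real.rpow_natCast, ← Real.rpow_mul (by positivity),
      ← Real.rpow_mul (by positivity), mul_comm]
  have h10 : ∏ q ∈ n.primeFactors, (if q < K then c else 1) ≤ c ^ K := by
    rw [Finset.prod_ite, Finset.prod_const_one, mul_one, Finset.prod_const]
    refine pow_le_pow_right₀ hc1 ?_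
    calc _ ≤ (Finset.range K).card := Finset.card_le_card fun q hq => by
            simp at hq ⊢; exact hq.2
      _ = K := Finset.card_range K
  calc ∏ q ∈ n.primeFactors, ((n.factorization q : ℝ) + 1)
      ≤ ∏ q ∈ n.primeFactors, ((if q < K then c else 1) * ((q : ℝ) ^ ε) ^ n.factorization q) :=
        Finset.prod_le_prod (fun _ _ => by positivity) fun q hq => by
          have := key q hq; push_cast at this; exact this
    _ = _ := Finset.prod_mul_distrib
    _ ≤ c ^ K * (n : ℝ) ^ ε := by rw [h9]; gcongr

/-! ### Brackets and sums of their powers. -/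

/-- The bracket `1 + |x|` of an integer. -/
noncomputable def bracket (x : ℤ) : ENNReal := 1 + (x.natAbs : ENNReal)

theorem one_le_bracket (x : ℤ) : 1 ≤ bracket x := le_self_add

theorem bracket_ne_zero (x : ℤ) : bracket x ≠ 0 :=
  (zero_lt_one.trans_le (one_le_bracket x)).ne'

theorem bracket_ne_top (x : ℤ) : bracket x ≠ ⊤ := by simp [bracket]

@[simp] theorem bracket_zero : bracket 0 = 1 := by simp [bracket]

@[simp] theorem bracket_neg (x : ℤ) : bracket (-x) = bracket x := by simp [bracket]

theorem bracket_add_le (x y : ℤ) : bracket (x + y) ≤ bracket x + bracket y := by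
  unfold bracket
  have : ((x + y).natAbs : ENNReal) ≤ x.natAbs + y.natAbs := by
    exact_mod_cast Int.natAbs_add_le x y
  calc 1 + ((x + y).natAbs : ENNReal) ≤ 1 + (x.natAbs + y.natAbs) := by gcongr
    _ ≤ 1 + (x.natAbs + y.natAbs) + 1 := le_self_add
    _ = _ := by ring

theorem bracket_add_le_mul (x y : ℤ) : bracket (x + y) ≤ bracket x * bracket y := by
  unfold bracket
  have : ((x + y).natAbs : ENNReal) ≤ x.natAbs + y.natAbs := by
    exact_mod_cast Int.natAbs_add_le x y
  calc 1 + ((x + y).natAbs : ENNReal) ≤ 1 + (x.natAbs + y.natAbs) := by gcongr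
    _ ≤ 1 + (x.natAbs + y.natAbs) + x.natAbs * y.natAbs := le_self_add
    _ = _ := by ring

theorem bracket_mono {x y : ℤ} (h : x.natAbs ≤ y.natAbs) : bracket x ≤ bracket y := by
  unfold bracket
  have : (x.natAbs : ENNReal) ≤ y.natAbs := by exact_mod_cast h
  gcongr

theorem bracket_rpow_add (x : ℤ) (a b : ℝ) :
    bracket x ^ (a + b) = bracket x ^ a * bracket x ^ b :=
  ENNReal.rpow_add _ _ (bracket_ne_zero x) (bracket_ne_top x)

theorem bracket_rpow_mono (x : ℤ) {a b : ℝ} (h : a ≤ b) : bracket x ^ a ≤ bracket x ^ b :=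
  ENNReal.rpow_le_rpow_of_exponent_le (one_le_bracket x) h

theorem one_le_bracket_rpow (x : ℤ) {a : ℝ} (h : 0 ≤ a) : 1 ≤ bracket x ^ a :=
  by simpa using bracket_rpow_mono x h

theorem bracket_rpow_mul_neg (x : ℤ) (a : ℝ) : bracket x ^ a * bracket x ^ (-a) = 1 := by
  rw [← bracket_rpow_add]; simp

theorem tsum_bracket_rpow_ne_top {κ : ℝ} (hκ : 1 < κ) : ∑' x : ℤ, bracket x ^ (-κ) ≠ ⊤ := by
  have h := Real.summable_abs_int_rpow hκ
  have h1 : ∀ x : ℤ, bracket x ^ (-κ) ≤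
      ENNReal.ofReal (|(x : ℝ)| ^ (-κ)) + Pi.single (M := fun _ => ENNReal) 0 1 x := by
    intro x
    by_cases hx : x = 0
    · subst hx; simp
    · have hx' : 0 < |(x : ℝ)| := by positivity
      refine le_trans ?_ le_self_add
      rw [← ENNReal.ofReal_rpow_of_pos hx', ENNReal.rpow_neg, ENNReal.rpow_neg]
      refine ENNReal.inv_le_inv.mpr (ENNReal.rpow_le_rpow ?_ (by linarith))
      rw [bracket, ← Int.cast_abs, Int.abs_eq_natAbs, Int.cast_natCast, ENNReal.ofReal_natCast]
      exact le_add_self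
  refine ne_top_of_le_ne_top ?_ (ENNReal.tsum_le_tsum h1)
  rw [ENNReal.tsum_add, tsum_pi_single]
  exact ENNReal.add_ne_top.mpr ⟨h.tsum_ofReal_ne_top, by simp⟩

/-- One of `x` and `μ + x` has bracket at least half that of `μ`; its factor gives the decay in `μ`,
and the other factor is summable. -/
theorem tsum_bracket_mul_bracket_le {κ : ℝ} (hκ : 1 < κ) :
    ∃ C : ENNReal, C ≠ ⊤ ∧ ∀ μ : ℤ,
      ∑' x : ℤ, bracket x ^ (-κ) * bracket (μ + x) ^ (-κ) ≤ C * bracket μ ^ (-κ) := by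
  set S := ∑' x : ℤ, bracket x ^ (-κ) with hS
  refine ⟨2 ^ κ * (S + S), ?_, fun μ => ?_⟩
  · exact ENNReal.mul_ne_top (by simp) (by simp [tsum_bracket_rpow_ne_top hκ, S])
  have hpt : ∀ x : ℤ, bracket x ^ (-κ) * bracket (μ + x) ^ (-κ) ≤
      (2 ^ κ * bracket μ ^ (-κ)) * (bracket (μ + x) ^ (-κ) + bracket x ^ (-κ)) := by
    intro x
    have h1 : bracket μ ≤ 2 * max (bracket x) (bracket (μ + x)) := by
      have := bracket_add_le (μ + x) (-x)
      rw [add_neg_cancel_right, bracket_neg] at this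
      rw [two_mul]
      exact this.trans (by rw [add_comm]; exact add_le_add (le_max_left _ _) (le_max_right _ _))
    have h2 : bracket μ ^ κ * (bracket x ^ (-κ) * bracket (μ + x) ^ (-κ)) ≤
        2 ^ κ * (bracket (μ + x) ^ (-κ) + bracket x ^ (-κ)) := by
      have h3 : bracket μ ^ κ ≤ 2 ^ κ * max (bracket x) (bracket (μ + x)) ^ κ := by
        rw [← ENNReal.mul_rpow_of_nonneg _ _ (by linarith : (0 : ℝ) ≤ κ)]
        exact ENNReal.rpow_le_rpow h1 (by linarith)
      refine (mul_le_mul_left h3 _).trans ?_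
      rw [mul_assoc]
      refine mul_le_mul_right ?_ _
      rcases max_cases (bracket x) (bracket (μ + x)) with ⟨h, -⟩ | ⟨h, -⟩ <;> rw [h]
      · rw [← mul_assoc, bracket_rpow_mul_neg, one_mul]; exact le_self_add
      · rw [mul_left_comm, bracket_rpow_mul_neg, mul_one]; exact le_add_self
    calc bracket x ^ (-κ) * bracket (μ + x) ^ (-κ)
        = (bracket μ ^ κ * bracket μ ^ (-κ)) * (bracket x ^ (-κ) * bracket (μ + x) ^ (-κ)) := by
          rw [bracket_rpow_mul_neg, one_mul]
      _ = bracket μ ^ (-κ) *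
          (bracket μ ^ κ * (bracket x ^ (-κ) * bracket (μ + x) ^ (-κ))) := by ring
      _ ≤ bracket μ ^ (-κ) * (2 ^ κ * (bracket (μ + x) ^ (-κ) + bracket x ^ (-κ))) := by gcongr
      _ = _ := by ring
  refine (ENNReal.tsum_le_tsum hpt).trans ?_
  rw [ENNReal.tsum_mul_left, ENNReal.tsum_add]
  have : ∑' x : ℤ, bracket (μ + x) ^ (-κ) = S :=
    (Equiv.addLeft μ).tsum_eq fun x => bracket x ^ (-κ)
  rw [this]
  exact le_of_eq (by ring)

/-- Sums over `Fin n → ℤ` of a product of brackets against a bracket of the sum. -/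
theorem tsum_prod_bracket_mul_bracket_le {κ : ℝ} (hκ : 1 < κ) (n : ℕ) :
    ∃ C : ENNReal, C ≠ ⊤ ∧ ∀ μ : ℤ,
      ∑' x : Fin n → ℤ, (∏ i, bracket (x i) ^ (-κ)) * bracket (μ + ∑ i, x i) ^ (-κ) ≤
        C * bracket μ ^ (-κ) := by
  induction n with
  | zero => exact ⟨1, by simp, fun μ => by simp⟩
  | succ n ih =>
    obtain ⟨C, hC, h⟩ := ih
    obtain ⟨C', hC', h'⟩ := tsum_bracket_mul_bracket_le hκ
    refine ⟨C * C', ENNReal.mul_ne_top hC hC', fun μ => ?_⟩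
    rw [← (Fin.consEquiv fun _ : Fin (n + 1) => ℤ).tsum_eq, ENNReal.tsum_prod']
    calc _ = ∑' (a : ℤ), bracket a ^ (-κ) * ∑' (x : Fin n → ℤ),
            (∏ i, bracket (x i) ^ (-κ)) * bracket ((μ + a) + ∑ i, x i) ^ (-κ) := by
          refine tsum_congr fun a => ?_
          rw [← ENNReal.tsum_mul_left]
          refine tsum_congr fun x => ?_
          simp [Fin.consEquiv, Fin.prod_univ_succ, Fin.sum_univ_succ, mul_assoc, add_assoc]
      _ ≤ ∑' (a : ℤ), bracket a ^ (-κ) * (C * bracket (μ + a) ^ (-κ)) :=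
          ENNReal.tsum_le_tsum fun a => by gcongr; exact h _
      _ = C * ∑' (a : ℤ), bracket a ^ (-κ) * bracket (μ + a) ^ (-κ) := by
          rw [← ENNReal.tsum_mul_left]; exact tsum_congr fun a => by ring
      _ ≤ C * (C' * bracket μ ^ (-κ)) := by gcongr; exact h' _
      _ = _ := by ring

theorem tsum_dvd_le (m : ℤ) (hm : m ≠ 0) :
    ∑' a : ℤ, (if a ∣ m then 1 else 0 : ENNReal) ≤ 2 * (m.natAbs.divisors.card : ENNReal) := by
  classical
  set s : Finset ℤ := m.natAbs.divisors.image (fun n : ℕ => (n : ℤ)) ∪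
    m.natAbs.divisors.image (fun n : ℕ => -(n : ℤ)) with hs
  rw [tsum_eq_sum (s := s)]
  · calc ∑ a ∈ s, (if a ∣ m then 1 else 0 : ENNReal) ≤ ∑ a ∈ s, 1 := by
          gcongr; split_ifs <;> simp
      _ = (s.card : ENNReal) := by simp
      _ ≤ ((m.natAbs.divisors.card + m.natAbs.divisors.card : ℕ) : ENNReal) := by
          exact_mod_cast (Finset.card_union_le _ _).trans
            (add_le_add Finset.card_image_le Finset.card_image_le)
      _ = _ := by push_cast; ring
  · intro a ha
    rw [if_neg]
    intro hd
    apply ha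
    have h1 : a.natAbs ∈ m.natAbs.divisors :=
      Nat.mem_divisors.mpr ⟨Int.natAbs_dvd_natAbs.mpr hd, by simpa using hm⟩
    rw [hs, Finset.mem_union, Finset.mem_image, Finset.mem_image]
    rcases Int.natAbs_eq a with h | h
    · exact Or.inl ⟨_, h1, h.symm⟩
    · exact Or.inr ⟨_, h1, h.symm⟩

/-- Summation of a bracket over the products of nonzero integers. -/
theorem tsum_bracket_mul_le {κ ε : ℝ} (hε : 0 < ε) (hκ : 1 + ε < κ) :
    ∃ C : ENNReal, C ≠ ⊤ ∧ ∀ (s : ℤ) (_ : s ≠ 0) (μ : ℤ),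
      ∑' (a : ℤ) (b : ℤ), (if a ≠ 0 ∧ b ≠ 0 then bracket (μ + s * (a * b)) ^ (-κ) else 0) ≤
        C * bracket μ ^ ε := by
  obtain ⟨D, hD0, hD⟩ := card_divisors_le_rpow hε
  set S := ∑' x : ℤ, bracket x ^ (-(κ - ε)) with hS
  refine ⟨2 * ENNReal.ofReal D * S, ?_, fun s hs μ => ?_⟩
  · exact ENNReal.mul_ne_top (ENNReal.mul_ne_top (by simp) (by simp))
      (tsum_bracket_rpow_ne_top (by linarith))
  have h1 : ∀ a b : ℤ, (if a ≠ 0 ∧ b ≠ 0 then bracket (μ + s * (a * b)) ^ (-κ) else 0) =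
      ∑' m : ℤ, (if m ≠ 0 ∧ a * b = m then bracket (μ + s * m) ^ (-κ) else 0) := by
    intro a b
    rw [tsum_eq_single (a * b)]
    · simp
    · intro m hm; rw [if_neg]; exact fun h => hm h.2.symm
  have h2 : ∀ m : ℤ, ∑' (a : ℤ) (b : ℤ),
      (if m ≠ 0 ∧ a * b = m then bracket (μ + s * m) ^ (-κ) else 0) ≤
        2 * ENNReal.ofReal D * bracket μ ^ ε * bracket (μ + s * m) ^ (-(κ - ε)) := by
    intro m
    by_cases hm : m = 0
    · simp [hm]
    have h3 : ∀ a : ℤ, ∑' b : ℤ, (if m ≠ 0 ∧ a * b = m then bracket (μ + s * m) ^ (-κ) else 0) ≤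
        (if a ∣ m then 1 else 0) * bracket (μ + s * m) ^ (-κ) := by
      intro a
      by_cases ha : a ∣ m
      · obtain ⟨b₀, rfl⟩ := ha
        have ha0 : a ≠ 0 := by rintro rfl; simp at hm
        rw [tsum_eq_single b₀]
        · simp [hm]
        · intro b hb
          rw [if_neg]
          exact fun h => hb (mul_left_cancel₀ ha0 h.2)
      · have : ∀ b, ¬ (m ≠ 0 ∧ a * b = m) := fun b h => ha ⟨b, h.2.symm⟩
        simp [this]
    refine (ENNReal.tsum_le_tsum h3).trans ?_
    rw [ENNReal.tsum_mul_right]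
    -- This splits the divisor bound `⟨m⟩ ^ ε` into the loss `⟨μ⟩ ^ ε` and a factor absorbed by the
    -- decay in `μ + s m`.
    have h4 : bracket m ≤ bracket μ * bracket (μ + s * m) := by
      have h5 := bracket_add_le_mul (-μ) (μ + s * m)
      rw [neg_add_cancel_left, bracket_neg] at h5
      refine (bracket_mono ?_).trans h5
      rw [Int.natAbs_mul]
      exact Nat.le_mul_of_pos_left _ (Int.natAbs_pos.mpr hs)
    have h6 : (m.natAbs.divisors.card : ENNReal) ≤ ENNReal.ofReal D * bracket m ^ ε := by
      have h7 := hD m.natAbs (by simpa using hm)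
      have h8 : (m.natAbs.divisors.card : ENNReal) ≤
          ENNReal.ofReal D * (m.natAbs : ENNReal) ^ ε := by
        rw [← ENNReal.ofReal_natCast, ← ENNReal.ofReal_natCast,
          ENNReal.ofReal_rpow_of_nonneg (by positivity) hε.le, ← ENNReal.ofReal_mul hD0.le]
        exact ENNReal.ofReal_le_ofReal h7
      refine h8.trans ?_
      gcongr
      rw [bracket]; exact le_add_self
    calc _ ≤ 2 * (ENNReal.ofReal D * (bracket μ * bracket (μ + s * m)) ^ ε) *
          bracket (μ + s * m) ^ (-κ) := by
          gcongr
          refine (tsum_dvd_le m hm).trans ?_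
          gcongr
          refine h6.trans ?_
          gcongr
      _ = _ := by
          rw [ENNReal.mul_rpow_of_nonneg _ _ hε.le, show -(κ - ε) = ε + -κ by ring,
            bracket_rpow_add]
          ring
  calc _ = ∑' (m : ℤ) (a : ℤ) (b : ℤ),
        (if m ≠ 0 ∧ a * b = m then bracket (μ + s * m) ^ (-κ) else 0) := by
        simp_rw [h1]
        rw [ENNReal.tsum_comm]
        conv_lhs => enter [1, b]; rw [ENNReal.tsum_comm]
        rw [ENNReal.tsum_comm]
        exact tsum_congr fun m => ENNReal.tsum_comm
    _ ≤ ∑' m : ℤ, 2 * ENNReal.ofReal D * bracket μ ^ ε * bracket (μ + s * m) ^ (-(κ - ε)) :=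
        ENNReal.tsum_le_tsum h2
    _ = 2 * ENNReal.ofReal D * bracket μ ^ ε * ∑' m : ℤ, bracket (μ + s * m) ^ (-(κ - ε)) :=
        ENNReal.tsum_mul_left
    _ ≤ 2 * ENNReal.ofReal D * bracket μ ^ ε * S := by
        gcongr
        refine ENNReal.tsum_comp_le_tsum_of_injective (f := fun m : ℤ => μ + s * m) ?_
          (fun x => bracket x ^ (-(κ - ε)))
        intro x y h
        exact mul_left_cancel₀ hs (add_left_cancel h)
    _ = _ := by ring

/-! ### Fourier coefficients of integration in time. -/

/-- The majorant, up to a constant and a power of `bracket ρ`, of the Fourier coefficients of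
`t ↦ ∫ r in 0..t, exp (i ρ r)` on `[0, 1]`. -/
noncomputable def kernelWeight (ρ τ : ℤ) : ENNReal :=
  (if τ = ρ then 1 else 0) + (if τ = 0 then 1 else 0) +
    (if ρ = 0 then bracket τ ^ (-2 : ℝ) else 0)

/-- The Fourier coefficients of an extension of the identity function of `[0, 1]`. -/
noncomputable def triangleCoeff (τ : ℤ) : ℂ :=
  (if τ = 0 then (Real.pi : ℂ) / 2 else 0) -
    (1 / Real.pi) * (1 / (τ : ℂ) ^ 2) * (1 - Complex.exp (Real.pi * Complex.I * τ))

/-- The Fourier coefficients of an extension of the function `t ↦ ∫ r in 0..t, exp (i ρ r)`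
of `[0, 1]`. -/
noncomputable def fourierKernel (ρ τ : ℤ) : ℂ :=
  if ρ = 0 then triangleCoeff τ else
    ((if τ = ρ then 1 else 0) - (if τ = 0 then 1 else 0)) / (Complex.I * ρ)

/-- The extension is the `2π`-periodic triangle wave equal to `|t|` on `[-π, π]`; its continuity is
what gives coefficients of order `τ⁻²`. With `x = t / 2π`, the series comes from `B₂(x) - B₂(x +
1/2) = 1/4 - x`. -/
theorem hasSum_triangleCoeff {t : ℝ} (ht : t ∈ Set.Icc (0 : ℝ) 1) :
    HasSum (fun τ : ℤ => triangleCoeff τ * Complex.exp (Complex.I * τ * t)) (t : ℂ) := by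
  have hpi := Real.pi_gt_three
  have hpi0 : (Real.pi : ℂ) ≠ 0 := by exact_mod_cast Real.pi_ne_zero
  set x : ℝ := t / (2 * Real.pi) with hx
  have hx0 : 0 ≤ x := div_nonneg ht.1 (by positivity)
  have hx1 : x ≤ 1 / 2 := by
    rw [hx, div_le_iff₀ (by positivity)]; linarith [ht.2]
  have h1 := hasSum_one_div_pow_mul_fourier_mul_bernoulliFun (k := 2) le_rfl (x := x)
    ⟨hx0, by linarith⟩
  have h2 := hasSum_one_div_pow_mul_fourier_mul_bernoulliFun (k := 2) le_rfl (x := x + 1 / 2)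
    ⟨by linarith, by linarith⟩
  have h3 := (h1.sub h2).mul_left (-(1 / Real.pi) : ℂ)
  have h4 : HasSum (fun τ : ℤ => if τ = 0 then (Real.pi : ℂ) / 2 else 0) ((Real.pi : ℂ) / 2) := by
    have := hasSum_ite_eq (0 : ℤ) ((Real.pi : ℂ) / 2)
    exact this
  convert h4.add h3 using 1
  · funext τ
    rw [fourier_coe_apply, fourier_coe_apply]
    have e1 : 2 * (Real.pi : ℂ) * Complex.I * τ * (x : ℂ) / (1 : ℝ) = Complex.I * τ * t := by
      rw [hx]; push_cast; field_simp
    have e2 : 2 * (Real.pi : ℂ) * Complex.I * τ * ((x + 1 / 2 : ℝ) : ℂ) / (1 : ℝ) =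
        Complex.I * τ * t + Real.pi * Complex.I * τ := by
      rw [hx]; push_cast; field_simp
    rw [e1, e2, Complex.exp_add, triangleCoeff]
    split_ifs with h
    · subst h; simp
    · ring
  · have b2 : ∀ y : ℝ, bernoulliFun 2 y = y ^ 2 - y + 1 / 6 := by
      intro y
      rw [bernoulliFun, Polynomial.bernoulli_def]
      simp [Finset.sum_range_succ, bernoulli_eq_bernoulli'_of_ne_one, bernoulli_one, Polynomial.eval_add,
        bernoulli'_two]
      ring
    rw [b2, b2, hx]
    push_cast
    simp only [mul_pow, Complex.I_sq, Nat.factorial]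
    field_simp
    push_cast
    ring

theorem norm_triangleCoeff_le (τ : ℤ) : ‖triangleCoeff τ‖ₑ ≤ 4 * bracket τ ^ (-2 : ℝ) := by
  have hpi := Real.pi_gt_three
  by_cases h : τ = 0
  · subst h
    simp only [triangleCoeff, if_true, Int.cast_zero]
    simp only [bracket_zero, ENNReal.one_rpow]
    simp only [ne_eq, OfNat.ofNat_ne_zero, not_false_eq_true, zero_pow, div_zero, mul_zero, zero_mul,
      sub_zero, mul_one]
    rw [← ofReal_norm]
    refine ENNReal.ofReal_le_of_le_toReal ?_
    have := Real.pi_lt_four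
    rw [norm_div, Complex.norm_real, Real.norm_of_nonneg (by positivity)]
    simp
    linarith
  · have h0 : (1 : ℝ) ≤ |(τ : ℝ)| := by
      exact_mod_cast Int.one_le_abs h
    have h1 : ‖triangleCoeff τ‖ ≤ 4 * (1 + |(τ : ℝ)|) ^ (-2 : ℝ) := by
      rw [triangleCoeff, if_neg h, zero_sub, norm_neg, norm_mul, norm_mul]
      have e1 : ‖(1 : ℂ) - Complex.exp (Real.pi * Complex.I * τ)‖ ≤ 2 := by
        refine (norm_sub_le _ _).trans ?_
        rw [show (Real.pi : ℂ) * Complex.I * τ = ((Real.pi * τ : ℝ) : ℂ) * Complex.I by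
          push_cast; ring, Complex.norm_exp_ofReal_mul_I]
        norm_num
      have e2 : ‖(1 : ℂ) / Real.pi‖ ≤ 1 / 2 := by
        rw [norm_div, norm_one, Complex.norm_real, Real.norm_of_nonneg (by positivity)]
        exact one_div_le_one_div_of_le (by norm_num) (by linarith)
      have e3 : ‖(1 : ℂ) / (τ : ℂ) ^ 2‖ = 1 / |(τ : ℝ)| ^ 2 := by
        rw [norm_div, norm_one, norm_pow, Complex.norm_intCast]
      rw [e3]
      calc _ ≤ 1 / 2 * (1 / |(τ : ℝ)| ^ 2) * 2 := by gcongr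
        _ = 1 / |(τ : ℝ)| ^ 2 := by ring
        _ ≤ 4 / (1 + |(τ : ℝ)|) ^ 2 := by
            rw [div_le_div_iff₀ (by positivity) (by positivity)]
            nlinarith
        _ = _ := by
            rw [Real.rpow_neg (by positivity), div_eq_mul_inv, Real.rpow_two]
    rw [← ofReal_norm]
    refine (ENNReal.ofReal_le_ofReal h1).trans ?_
    rw [ENNReal.ofReal_mul (by norm_num), ← ENNReal.ofReal_rpow_of_pos (by positivity)]
    rw [ENNReal.ofReal_add (by norm_num) (by positivity), bracket, ← Int.cast_abs, Int.abs_eq_natAbs,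
      Int.cast_natCast, ENNReal.ofReal_natCast]
    simp

theorem enorm_fourierKernel_le (ρ τ : ℤ) :
    ‖fourierKernel ρ τ‖ₑ ≤ 4 * (bracket ρ ^ (-1 : ℝ) * kernelWeight ρ τ) := by
  by_cases h : ρ = 0
  · subst h
    simp only [fourierKernel, if_true, kernelWeight, bracket_zero, ENNReal.one_rpow, one_mul]
    refine (norm_triangleCoeff_le τ).trans ?_
    gcongr
    exact le_add_self
  · simp only [fourierKernel, if_neg h, kernelWeight, add_zero]
    have h0 : (1 : ℝ) ≤ |(ρ : ℝ)| := by exact_mod_cast Int.one_le_abs h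
    have h1 : ‖(Complex.I * ρ)⁻¹‖ₑ ≤ 4 * bracket ρ ^ (-1 : ℝ) := by
      rw [← ofReal_norm, norm_inv, norm_mul, Complex.norm_I, one_mul, Complex.norm_intCast]
      have : |(ρ : ℝ)|⁻¹ ≤ 4 * (1 + |(ρ : ℝ)|)⁻¹ := by
        rw [← div_eq_mul_inv, ← one_div, div_le_div_iff₀ (by positivity) (by positivity)]
        linarith
      refine (ENNReal.ofReal_le_ofReal this).trans ?_
      rw [ENNReal.ofReal_mul (by norm_num), ENNReal.ofReal_inv_of_pos (by positivity),
        ENNReal.rpow_neg_one, ENNReal.ofReal_add (by norm_num) (by positivity), bracket,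
        ← Int.cast_abs, Int.abs_eq_natAbs, Int.cast_natCast, ENNReal.ofReal_natCast]
      simp
    rw [div_eq_mul_inv, enorm_mul, mul_comm, ← mul_assoc]
    refine mul_le_mul' h1 (enorm_sub_le.trans ?_)
    gcongr <;> split_ifs <;> simp

theorem hasSum_fourierKernel (ρ : ℤ) {t : ℝ} (ht : t ∈ Set.Icc (0 : ℝ) 1) :
    HasSum (fun τ : ℤ => fourierKernel ρ τ * Complex.exp (Complex.I * τ * t))
      (∫ r in (0 : ℝ)..t, Complex.exp (Complex.I * ρ * r)) := by
  by_cases h : ρ = 0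
  · subst h
    simpa [fourierKernel] using hasSum_triangleCoeff ht
  · have h0 : Complex.I * (ρ : ℂ) ≠ 0 := mul_ne_zero Complex.I_ne_zero (by exact_mod_cast h)
    rw [integral_exp_mul_complex h0]
    have h1 := hasSum_ite_eq ρ (Complex.exp (Complex.I * ρ * t) / (Complex.I * ρ))
    have h2 := hasSum_ite_eq (0 : ℤ) (1 / (Complex.I * ρ))
    have h3 : (Complex.exp (Complex.I * ρ * t) - Complex.exp (Complex.I * ρ * (0 : ℝ))) /
        (Complex.I * ρ) =
        Complex.exp (Complex.I * ρ * t) / (Complex.I * ρ) - 1 / (Complex.I * ρ) := by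
      simp [sub_div]
    rw [h3]
    refine (h1.sub h2).congr_fun fun τ => ?_
    simp only [fourierKernel, if_neg h]
    by_cases h3 : τ = ρ
    · subst h3; simp only [h, if_true, if_false]; ring
    · by_cases h4 : τ = 0
      · subst h4; simp only [h3, if_true, if_false, zero_sub, mul_zero, zero_mul, Int.cast_zero,
          Complex.exp_zero]; ring
      · simp [h3, h4]

/-- The weight lives on the frequencies `ρ` and `0`, apart from the tail `⟨τ⟩⁻²` when `ρ = 0`; `ε <
1` keeps that tail summable. -/
theorem tsum_kernelWeight_mul_le {ε : ℝ} (hε : 0 ≤ ε) (hε1 : ε < 1) :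
    ∃ C : ENNReal, C ≠ ⊤ ∧ ∀ ρ : ℤ,
      ∑' τ : ℤ, bracket τ ^ ε * kernelWeight ρ τ ≤ C * bracket ρ ^ ε := by
  refine ⟨2 + ∑' τ : ℤ, bracket τ ^ (-(2 - ε)), ?_, fun ρ => ?_⟩
  · exact ENNReal.add_ne_top.mpr ⟨by simp, tsum_bracket_rpow_ne_top (by linarith)⟩
  have h1 : ∀ τ : ℤ, bracket τ ^ ε * kernelWeight ρ τ ≤
      ((if τ = ρ then bracket ρ ^ ε else 0) + (if τ = 0 then 1 else 0)) +
        bracket τ ^ (-(2 - ε)) := by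
    intro τ
    rw [kernelWeight, mul_add, mul_add]
    refine add_le_add (add_le_add ?_ ?_) ?_
    · by_cases h : τ = ρ <;> simp [h]
    · by_cases h : τ = 0 <;> simp [h]
    · by_cases h : ρ = 0
      · rw [if_pos h, ← bracket_rpow_add]
        exact bracket_rpow_mono _ (by linarith)
      · simp [h]
  refine (ENNReal.tsum_le_tsum h1).trans ?_
  rw [ENNReal.tsum_add, ENNReal.tsum_add, tsum_ite_eq, tsum_ite_eq, add_mul]
  have h2 := one_le_bracket_rpow ρ hε
  refine add_le_add ?_ (le_mul_of_one_le_right zero_le h2)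
  rw [two_mul]
  exact add_le_add le_rfl h2

/-! ### Indicators, and sums over the indices at a single node. -/

open Classical in
/-- The indicator of a proposition, with values in `[0, ∞]`. -/
noncomputable def ind (p : Prop) : ENNReal := if p then 1 else 0

theorem ind_of {p : Prop} (h : p) : ind p = 1 := if_pos h

theorem ind_of_not {p : Prop} (h : ¬ p) : ind p = 0 := if_neg h

theorem ind_le_one (p : Prop) : ind p ≤ 1 := by
  unfold ind; split_ifs <;> simp

theorem ind_and (p r : Prop) : ind (p ∧ r) = ind p * ind r := by
  by_cases h : p <;> by_cases h' : r <;> simp [ind, h, h']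

theorem tsum_ind_eq_mul {α : Type*} (a : α) (F : α → ENNReal) :
    ∑' x, ind (a = x) * F x = F a := by
  rw [tsum_eq_single a]
  · simp [ind]
  · intro b hb; simp [ind, hb.symm]

theorem tsum_ind_mul_eq_tsum_subtype {α : Type*} (S : Set α) (F : α → ENNReal) :
    ∑' x, ind (x ∈ S) * F x = ∑' x : S, F x := by
  rw [tsum_subtype]
  refine tsum_congr fun x => ?_
  by_cases h : x ∈ S <;> simp [ind, h]

theorem tsum_ind_mul_eq_tsum_subtype' {α : Type*} (p : α → Prop) (F : α → ENNReal) :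
    ∑' x, ind (p x) * F x = ∑' x : {x // p x}, F x :=
  tsum_ind_mul_eq_tsum_subtype {x | p x} F

theorem tsum_ind_mul_le_of_injOn {α β : Type*} {S : Set α} {g : α → β} (hg : Set.InjOn g S)
    {F : α → ENNReal} {G : β → ENNReal} (h : ∀ x ∈ S, F x ≤ G (g x)) :
    ∑' x, ind (x ∈ S) * F x ≤ ∑' y, G y := by
  rw [tsum_ind_mul_eq_tsum_subtype]
  exact (ENNReal.tsum_le_tsum fun x : S => h x.1 x.2).trans
    (ENNReal.tsum_comp_le_tsum_of_injective (Set.injOn_iff_injective.mp hg) G)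

/-- The admissible indices `(j_v, (j_{v,1}, j_{v,2}, j_{v,3}))` at a node, which is simple or
general. -/
def nodeSet (simple : Prop) : Set (ℤ × (Fin 3 → ℤ)) :=
  {x | x.1 = x.2 0 - x.2 1 + x.2 2 ∧
    (¬ simple → ({x.1, x.2 1} ∩ {x.2 0, x.2 2} : Set ℤ) = ∅) ∧
    (simple → ∀ i : Fin 3, x.1 = x.2 i)}

/-- The phase at a node. -/
def nodePhase (s : ℤ) (x : ℤ × (Fin 3 → ℤ)) : ℤ :=
  s * resonance (x.2 0) (x.2 1) (x.2 2) x.1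

/-- The entries of a node index: the one at the node itself, and those at the three children. -/
def nodeCoord (c : Option (Fin 3)) (x : ℤ × (Fin 3 → ℤ)) : ℤ :=
  c.elim x.1 x.2

/-- This factorization is what brings in the divisor bound. -/
theorem resonance_eq {x : ℤ × (Fin 3 → ℤ)} (h : x.1 = x.2 0 - x.2 1 + x.2 2) :
    resonance (x.2 0) (x.2 1) (x.2 2) x.1 = 2 * ((x.1 - x.2 0) * (x.1 - x.2 2)) := by
  have h1 : x.2 1 = x.2 0 + x.2 2 - x.1 := by linarith
  rw [resonance, h1]; ring

/-- At a simple node the fixed entry leaves a single index. At a general node both factors of the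
resonance are nonzero, and together with any one entry they determine the index, so
`tsum_bracket_mul_le` applies. -/
theorem tsum_nodeSet_bracket_le {κ ε : ℝ} (hε : 0 < ε) (hκ : 1 + ε < κ) :
    ∃ C : ENNReal, C ≠ ⊤ ∧ ∀ (simple : Prop) (s : ℤ) (_ : s ≠ 0) (c : Option (Fin 3)) (z μ : ℤ),
      ∑' x : ℤ × (Fin 3 → ℤ), ind (x ∈ nodeSet simple ∧ nodeCoord c x = z) *
        bracket (μ + nodePhase s x) ^ (-κ) ≤ C * bracket μ ^ ε := by
  obtain ⟨C, hC, h⟩ := tsum_bracket_mul_le hε hκ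
  refine ⟨1 + C, by simp [hC], fun simple s hs c z μ => ?_⟩
  have hμ := one_le_bracket_rpow μ hε.le
  by_cases hsimple : simple
  · have h1 : ∀ x : ℤ × (Fin 3 → ℤ), x ∈ nodeSet simple ∧ nodeCoord c x = z →
        x = (z, fun _ => z) := by
      rintro ⟨n, q⟩ ⟨⟨-, -, h3⟩, h4⟩
      have h5 := h3 hsimple
      have hn : n = z := by
        cases c with
        | none => exact h4
        | some i => exact (h5 i).trans h4
      refine Prod.ext hn (funext fun i => ?_)
      rw [← hn]; exact (h5 i).symm
    rw [tsum_eq_single (z, fun _ => z)]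
    · calc _ ≤ (1 : ENNReal) * 1 := by
            refine mul_le_mul' (ind_le_one _) ?_
            simpa using bracket_rpow_mono (μ + nodePhase s (z, fun _ => z))
              (show -κ ≤ 0 by linarith)
        _ ≤ (1 + C) * bracket μ ^ ε := mul_le_mul' le_self_add hμ
    · intro x hx
      rw [ind_of_not (fun h' => hx (h1 x h')), zero_mul]
  · have h2 : ∀ x ∈ nodeSet simple, (x.1 - x.2 0 ≠ 0 ∧ x.1 - x.2 2 ≠ 0) := by
      rintro ⟨n, q⟩ ⟨-, h3, -⟩
      have h4 := h3 hsimple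
      constructor
      · intro h5
        have : n ∈ ({n, q 1} ∩ {q 0, q 2} : Set ℤ) := by
          have : n = q 0 := by simpa [sub_eq_zero] using h5
          simp [this]
        rw [h4] at this; exact this
      · intro h5
        have : n ∈ ({n, q 1} ∩ {q 0, q 2} : Set ℤ) := by
          have : n = q 2 := by simpa [sub_eq_zero] using h5
          simp [this]
        rw [h4] at this; exact this
    have hinj : Set.InjOn (fun x : ℤ × (Fin 3 → ℤ) => (x.1 - x.2 0, x.1 - x.2 2))
        {x | x ∈ nodeSet simple ∧ nodeCoord c x = z} := by
      rintro ⟨n, q⟩ ⟨⟨h3, -⟩, h4⟩ ⟨n', q'⟩ ⟨⟨h3', -⟩, h4'⟩ heq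
      simp only [Prod.mk.injEq] at heq
      simp only at h3 h3'
      obtain ⟨e1, e2⟩ := heq
      have hc : n = n' := by
        cases c with
        | none => simp only [nodeCoord, Option.elim] at h4 h4'; omega
        | some i =>
          fin_cases i <;> simp [nodeCoord] at h4 h4' <;> omega
      refine Prod.ext hc (funext fun i => ?_)
      fin_cases i <;> simp <;> omega
    refine (tsum_ind_mul_le_of_injOn hinj (G := fun y : ℤ × ℤ =>
      if y.1 ≠ 0 ∧ y.2 ≠ 0 then bracket (μ + (s * 2) * (y.1 * y.2)) ^ (-κ) else 0) ?_).trans ?_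
    · rintro x ⟨hx, -⟩
      rw [if_pos (h2 x hx), nodePhase, resonance_eq hx.1, mul_assoc]
    · rw [ENNReal.tsum_prod']
      refine (h (s * 2) (by omega) μ).trans ?_
      gcongr
      exact le_add_self

theorem tsum_nodeSet_bracket_root_le {κ ε : ℝ} (hε : 0 < ε) (hκ : 1 + ε < κ) :
    ∃ C : ENNReal, C ≠ ⊤ ∧ ∀ (simple : Prop) (s : ℤ) (_ : s ≠ 0) (n μ : ℤ),
      ∑' q : Fin 3 → ℤ, ind ((n, q) ∈ nodeSet simple) *
        bracket (μ + nodePhase s (n, q)) ^ (-κ) ≤ C * bracket μ ^ ε := by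
  obtain ⟨C, hC, h⟩ := tsum_nodeSet_bracket_le hε hκ
  refine ⟨C, hC, fun simple s hs n μ => le_trans ?_ (h simple s hs none n μ)⟩
  refine le_trans (le_of_eq ?_) (ENNReal.tsum_comp_le_tsum_of_injective
    (f := fun q : Fin 3 → ℤ => (n, q)) (Prod.mk_right_injective n) _)
  simp [nodeCoord]

/-- Exchanges decay in the incoming frequency `ρ` for decay in the outgoing `τ`, leaving a summable
factor. When `ρ = 0` the decay in `τ` is only `⟨τ⟩⁻²`, whence `s ≤ 2`. -/
theorem bracket_mul_kernelWeight_le {κ s : ℝ} (hs : κ ≤ s) (hs2 : s ≤ 2) (ρ τ : ℤ) :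
    bracket ρ ^ (-s) * kernelWeight ρ τ ≤ bracket τ ^ (-s) * bracket (-τ + ρ) ^ (-κ) +
      2 * (bracket τ ^ (-s) * bracket ρ ^ (-κ)) := by
  rw [kernelWeight, mul_add, mul_add, two_mul, ← add_assoc]
  refine add_le_add (add_le_add ?_ ?_) ?_
  · by_cases h : τ = ρ
    · subst h; simp
    · simp [h]
  · by_cases h : τ = 0
    · subst h; simpa using bracket_rpow_mono ρ (neg_le_neg hs)
    · simp [h]
  · by_cases h : ρ = 0
    · subst h; simpa using bracket_rpow_mono τ (neg_le_neg hs2)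
    · simp [h]

/-- Propagation through a node of pointwise bounds for the sums with fixed index at the root. -/
theorem tsum_node_root_le {κ ε s : ℝ} (hε : 0 < ε) (hκ : 1 + ε < κ) (hs : s = κ + ε)
    (hs2 : s ≤ 2) :
    ∃ C : ENNReal, C ≠ ⊤ ∧ ∀ (simple : Prop) (sg : ℤ) (_ : sg ≠ 0) (n τ : ℤ)
      (β : Fin 3 → ℤ → ℤ → ENNReal) (B : Fin 3 → ENNReal),
      (∀ i m σ, β i m σ ≤ B i * bracket σ ^ (-κ)) →
      ∑' (q : Fin 3 → ℤ) (y : Fin 3 → ℤ), ind ((n, q) ∈ nodeSet simple) *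
        ((∏ i, β i (q i) (y i)) * (bracket (nodePhase sg (n, q) + ∑ i, y i) ^ (-s) *
          kernelWeight (nodePhase sg (n, q) + ∑ i, y i) τ)) ≤
        C * (∏ i, B i) * bracket τ ^ (-κ) := by
  obtain ⟨C₁, hC₁, h₁⟩ := tsum_prod_bracket_mul_bracket_le (κ := κ) (by linarith) 3
  obtain ⟨C₂, hC₂, h₂⟩ := tsum_nodeSet_bracket_root_le hε hκ
  refine ⟨3 * (C₁ * C₂), ENNReal.mul_ne_top (by simp) (ENNReal.mul_ne_top hC₁ hC₂),
    fun simple sg hsg n τ β B hβ => ?_⟩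
  set P := ∏ i, B i
  -- The frequencies of the branches are summed before the indices; these convolutions preserve the
  -- decay `-κ`.
  have hy : ∀ q : Fin 3 → ℤ, ∑' y : Fin 3 → ℤ,
      ((∏ i, β i (q i) (y i)) * (bracket (nodePhase sg (n, q) + ∑ i, y i) ^ (-s) *
          kernelWeight (nodePhase sg (n, q) + ∑ i, y i) τ)) ≤
      P * C₁ * bracket τ ^ (-s) * (bracket (-τ + nodePhase sg (n, q)) ^ (-κ) +
        2 * bracket (0 + nodePhase sg (n, q)) ^ (-κ)) := by
    intro q
    set φ := nodePhase sg (n, q)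
    calc _ ≤ ∑' y : Fin 3 → ℤ, (P * ∏ i, bracket (y i) ^ (-κ)) *
          (bracket τ ^ (-s) * bracket (-τ + (φ + ∑ i, y i)) ^ (-κ) +
            2 * (bracket τ ^ (-s) * bracket (φ + ∑ i, y i) ^ (-κ))) := by
          refine ENNReal.tsum_le_tsum fun y => mul_le_mul' ?_
            (bracket_mul_kernelWeight_le (by linarith) hs2 _ _)
          rw [← Finset.prod_mul_distrib]
          exact Finset.prod_le_prod' fun i _ => hβ i _ _
      _ = P * bracket τ ^ (-s) *
          (∑' y : Fin 3 → ℤ, (∏ i, bracket (y i) ^ (-κ)) *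
              bracket ((-τ + φ) + ∑ i, y i) ^ (-κ) +
            2 * ∑' y : Fin 3 → ℤ, (∏ i, bracket (y i) ^ (-κ)) *
              bracket ((0 + φ) + ∑ i, y i) ^ (-κ)) := by
          rw [← ENNReal.tsum_mul_left (a := 2), ← ENNReal.tsum_add, ← ENNReal.tsum_mul_left]
          refine tsum_congr fun y => ?_
          rw [zero_add, add_assoc]
          ring
      _ ≤ P * bracket τ ^ (-s) * (C₁ * bracket (-τ + φ) ^ (-κ) +
            2 * (C₁ * bracket (0 + φ) ^ (-κ))) := by
          gcongr
          · exact h₁ _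
          · exact h₁ _
      _ = _ := by ring
  calc _ ≤ ∑' q : Fin 3 → ℤ, ind ((n, q) ∈ nodeSet simple) *
        (P * C₁ * bracket τ ^ (-s) * (bracket (-τ + nodePhase sg (n, q)) ^ (-κ) +
        2 * bracket (0 + nodePhase sg (n, q)) ^ (-κ))) := by
        refine ENNReal.tsum_le_tsum fun q => ?_
        rw [ENNReal.tsum_mul_left]
        gcongr
        exact hy q
    _ = P * C₁ * bracket τ ^ (-s) *
        (∑' q : Fin 3 → ℤ, ind ((n, q) ∈ nodeSet simple) *
          bracket (-τ + nodePhase sg (n, q)) ^ (-κ) +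
        2 * ∑' q : Fin 3 → ℤ, ind ((n, q) ∈ nodeSet simple) *
          bracket (0 + nodePhase sg (n, q)) ^ (-κ)) := by
        rw [← ENNReal.tsum_mul_left (a := 2), ← ENNReal.tsum_add, ← ENNReal.tsum_mul_left]
        exact tsum_congr fun y => by ring
    _ ≤ P * C₁ * bracket τ ^ (-s) * (C₂ * bracket (-τ) ^ ε + 2 * (C₂ * bracket 0 ^ ε)) := by
        gcongr
        · exact h₂ simple sg hsg _ _
        · exact h₂ simple sg hsg _ _
    _ ≤ P * C₁ * bracket τ ^ (-s) * (C₂ * bracket τ ^ ε + 2 * (C₂ * bracket τ ^ ε)) := by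
        rw [bracket_neg]
        gcongr
        simpa using one_le_bracket τ
    _ = 3 * (C₁ * C₂) * P * (bracket τ ^ (-s) * bracket τ ^ ε) := by ring
    -- Since `s = κ + ε`, the loss from the divisor bound restores exactly the exponent `-κ` of the
    -- hypothesis.
    _ = _ := by rw [← bracket_rpow_add, hs]; congr 2; ring

/-- Propagation through a node of the sums with fixed index at a leaf under the child `i₀`. -/
theorem tsum_node_leaf_le {κ ε s : ℝ} (hε : 0 < ε) (hε1 : ε < 1) (hκ : 1 + ε < κ)
    (hs : s = κ + ε) :
    ∃ C : ENNReal, C ≠ ⊤ ∧ ∀ (simple : Prop) (sg : ℤ) (_ : sg ≠ 0) (i₀ : Fin 3)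
      (β : Fin 3 → ℤ → ℤ → ENNReal) (B : Fin 3 → ENNReal),
      (∀ i, i ≠ i₀ → ∀ m σ, β i m σ ≤ B i * bracket σ ^ (-κ)) →
      (∑' (m : ℤ) (σ : ℤ), β i₀ m σ * bracket σ ^ ε ≤ B i₀) →
      ∑' (x : ℤ × (Fin 3 → ℤ)) (y : Fin 3 → ℤ), ind (x ∈ nodeSet simple) *
        ((∏ i, β i (x.2 i) (y i)) * ∑' τ : ℤ, bracket τ ^ ε *
          (bracket (nodePhase sg x + ∑ i, y i) ^ (-s) *
          kernelWeight (nodePhase sg x + ∑ i, y i) τ)) ≤ C * ∏ i, B i := by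
  obtain ⟨C₁, hC₁, h₁⟩ := tsum_prod_bracket_mul_bracket_le (κ := κ) (by linarith) 2
  obtain ⟨C₂, hC₂, h₂⟩ := tsum_nodeSet_bracket_le hε hκ
  obtain ⟨C₃, hC₃, h₃⟩ := tsum_kernelWeight_mul_le hε.le hε1
  refine ⟨C₃ * (C₁ * C₂), ENNReal.mul_ne_top hC₃ (ENNReal.mul_ne_top hC₁ hC₂),
    fun simple sg hsg i₀ β B hβ hβ₀ => ?_⟩
  -- Summing over `τ` first costs `⟨ρ⟩ ^ ε`, again compensated by `s - ε = κ`.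
  have hK : ∀ ρ : ℤ, ∑' τ : ℤ, bracket τ ^ ε * (bracket ρ ^ (-s) * kernelWeight ρ τ) ≤
      C₃ * bracket ρ ^ (-κ) := by
    intro ρ
    rw [tsum_congr fun τ => mul_left_comm _ _ _, ENNReal.tsum_mul_left]
    calc _ ≤ bracket ρ ^ (-s) * (C₃ * bracket ρ ^ ε) := by gcongr; exact h₃ ρ
      _ = C₃ * (bracket ρ ^ (-s) * bracket ρ ^ ε) := by ring
      _ = _ := by rw [← bracket_rpow_add, hs]; congr 2; ring
  set P := ∏ k : Fin 2, B (i₀.succAbove k) with hP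
  have hy : ∀ x : ℤ × (Fin 3 → ℤ), ∑' y : Fin 3 → ℤ,
      (∏ i, β i (x.2 i) (y i)) * ∑' τ : ℤ, bracket τ ^ ε *
          (bracket (nodePhase sg x + ∑ i, y i) ^ (-s) *
          kernelWeight (nodePhase sg x + ∑ i, y i) τ) ≤
      C₃ * C₁ * P * ∑' a : ℤ, β i₀ (x.2 i₀) a * bracket (a + nodePhase sg x) ^ (-κ) := by
    intro x
    set φ := nodePhase sg x
    calc _ ≤ ∑' y : Fin 3 → ℤ, (∏ i, β i (x.2 i) (y i)) * (C₃ * bracket (φ + ∑ i, y i) ^ (-κ)) :=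
          ENNReal.tsum_le_tsum fun y => by gcongr; exact hK _
      _ = ∑' (a : ℤ) (z : Fin 2 → ℤ), (β i₀ (x.2 i₀) a *
            ∏ k, β (i₀.succAbove k) (x.2 (i₀.succAbove k)) (z k)) *
            (C₃ * bracket ((a + φ) + ∑ i, z i) ^ (-κ)) := by
          rw [← (Fin.insertNthEquiv (fun _ => ℤ) i₀).tsum_eq, ENNReal.tsum_prod']
          refine tsum_congr fun a => tsum_congr fun z => ?_
          rw [Fin.prod_univ_succAbove _ i₀, Fin.sum_univ_succAbove _ i₀]
          simp only [Fin.insertNthEquiv_apply, Fin.insertNth_apply_same,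
            Fin.insertNth_apply_succAbove]
          rw [← add_assoc, add_comm φ a]
      _ ≤ ∑' (a : ℤ) (z : Fin 2 → ℤ), (β i₀ (x.2 i₀) a * (P * ∏ k, bracket (z k) ^ (-κ))) *
            (C₃ * bracket ((a + φ) + ∑ i, z i) ^ (-κ)) := by
          refine ENNReal.tsum_le_tsum fun a => ENNReal.tsum_le_tsum fun z => ?_
          gcongr
          rw [hP, ← Finset.prod_mul_distrib]
          exact Finset.prod_le_prod' fun k _ => hβ _ (Fin.succAbove_ne i₀ k) _ _
      _ = ∑' a : ℤ, C₃ * P * β i₀ (x.2 i₀) a * ∑' z : Fin 2 → ℤ,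
            (∏ k, bracket (z k) ^ (-κ)) * bracket ((a + φ) + ∑ i, z i) ^ (-κ) := by
          refine tsum_congr fun a => ?_
          rw [← ENNReal.tsum_mul_left]
          exact tsum_congr fun z => by ring
      _ ≤ ∑' a : ℤ, C₃ * P * β i₀ (x.2 i₀) a * (C₁ * bracket (a + φ) ^ (-κ)) :=
          ENNReal.tsum_le_tsum fun a => by gcongr; exact h₁ _
      _ = _ := by
          rw [← ENNReal.tsum_mul_left]
          exact tsum_congr fun a => by ring
  calc _ ≤ ∑' x : ℤ × (Fin 3 → ℤ), ind (x ∈ nodeSet simple) *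
        (C₃ * C₁ * P * ∑' a : ℤ, β i₀ (x.2 i₀) a * bracket (a + nodePhase sg x) ^ (-κ)) := by
        refine ENNReal.tsum_le_tsum fun x => ?_
        rw [ENNReal.tsum_mul_left]
        gcongr
        exact hy x
    -- Grouping by the value `m` at the child `i₀` gives the node sum a fixed entry; its loss `⟨a⟩ ^
    -- ε` is then the weight in the hypothesis on `β i₀`.
    _ = ∑' x : ℤ × (Fin 3 → ℤ), ∑' m : ℤ, ind (x.2 i₀ = m) * ∑' a : ℤ,
        C₃ * C₁ * P * (β i₀ m a *
          (ind (x ∈ nodeSet simple) * bracket (a + nodePhase sg x) ^ (-κ))) := by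
        refine tsum_congr fun x => ?_
        rw [tsum_ind_eq_mul, ← mul_assoc, ← ENNReal.tsum_mul_left]
        exact tsum_congr fun a => by ring
    _ = C₃ * C₁ * P * ∑' (m : ℤ) (a : ℤ), β i₀ m a * ∑' x : ℤ × (Fin 3 → ℤ),
        ind (x ∈ nodeSet simple ∧ nodeCoord (some i₀) x = m) *
          bracket (a + nodePhase sg x) ^ (-κ) := by
        rw [ENNReal.tsum_comm, ← ENNReal.tsum_mul_left]
        refine tsum_congr fun m => ?_
        simp_rw [← ENNReal.tsum_mul_left]
        rw [ENNReal.tsum_comm]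
        refine tsum_congr fun a => tsum_congr fun x => ?_
        rw [ind_and, nodeCoord, Option.elim]
        ring
    _ ≤ C₃ * C₁ * P * ∑' (m : ℤ) (a : ℤ), β i₀ m a * (C₂ * bracket a ^ ε) := by
        gcongr
        exact h₂ simple sg hsg _ _ _
    _ = C₃ * C₁ * P * (C₂ * ∑' (m : ℤ) (a : ℤ), β i₀ m a * bracket a ^ ε) := by
        simp_rw [← ENNReal.tsum_mul_left]
        exact tsum_congr fun m => tsum_congr fun a => by ring
    _ ≤ C₃ * C₁ * P * (C₂ * B i₀) := by gcongr
    _ = _ := by rw [Fin.prod_univ_succAbove B i₀]; ring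

/-! ### Branches of a tree and induction on trees. -/

theorem Set.Iic_covBy_iff {V : Type*} [PartialOrder V] {a : V} {x y : Set.Iic a} :
    x ⋖ y ↔ x.1 ⋖ y.1 := by
  constructor
  · intro h
    refine ⟨h.1, fun c hxc hcy => ?_⟩
    exact h.2 (c := ⟨c, hcy.le.trans y.2⟩) hxc hcy
  · intro h
    exact ⟨h.1, fun c hxc hcy => h.2 (c := c.1) hxc hcy⟩

/-- A non-terminal node of a lower interval, as a node of the ambient order. -/
def NonterminalNode.ofIic {V : Type*} [PartialOrder V] {a : V}
    (u : NonterminalNode (Set.Iic a)) : NonterminalNode V :=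
  ⟨u.1.1, let ⟨w, hw⟩ := u.2; ⟨w.1, Set.Iic_covBy_iff.mp hw⟩⟩

/-- A terminal node of a lower interval, as a node of the ambient order. -/
def TerminalNode.ofIic {V : Type*} [PartialOrder V] {a : V}
    (u : TerminalNode (Set.Iic a)) : TerminalNode V :=
  ⟨u.1.1, fun w hw => u.2 ⟨w, hw.le.trans u.1.2⟩ (Set.Iic_covBy_iff.mpr hw)⟩

namespace OrnamentedTree

variable {V : Type*} [PartialOrder V]

theorem child_covBy (T : OrnamentedTree V) (v : NonterminalNode V) (i : Fin 3) :
    T.child v i ⋖ v.1 := by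
  have : T.child v i ∈ {w | w ⋖ v.1} := by
    rw [← T.range_child v]; exact ⟨i, rfl⟩
  exact this

/-- The tree of the descendants of a node. -/
def subtree (T : OrnamentedTree V) (a : V) : OrnamentedTree (Set.Iic a) where
  le_total_of_between v₁ v₂ v₃ v₄ := T.le_total_of_between v₁ v₂ v₃ v₄
  root := ⟨a, le_rfl⟩
  le_root v := v.2
  child u i := ⟨T.child u.ofIic i, (T.child_covBy u.ofIic i).le.trans u.1.2⟩
  child_injective u i k h := T.child_injective u.ofIic (Subtype.ext_iff.mp h)
  range_child u := by
    ext w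
    simp only [Set.mem_range, Set.mem_ofPred_eq, Set.Iic_covBy_iff]
    have h : w.1 ∈ Set.range (T.child u.ofIic) ↔ w.1 ⋖ u.1.1 := by
      rw [T.range_child]; exact Iff.rfl
    rw [← h]
    exact ⟨fun ⟨i, hi⟩ => ⟨i, congrArg Subtype.val hi⟩, fun ⟨i, hi⟩ => ⟨i, Subtype.ext hi⟩⟩
  sign u := T.sign u.1
  simple := {u | u.ofIic ∈ T.simple}
  coeff u i := T.coeff u.ofIic i

section Decomposition

variable (T : OrnamentedTree V) (r : NonterminalNode V)

/-- The tree of the descendants of the `i`-th child of `r`. -/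
abbrev branch (i : Fin 3) : OrnamentedTree (Set.Iic (T.child r i)) := T.subtree (T.child r i)

/-- A common descendant would make the two children comparable, and nothing lies strictly between a
node and its child. -/
theorem eq_of_le_child {v : V} {i k : Fin 3} (hi : v ≤ T.child r i)
    (hk : v ≤ T.child r k) : i = k := by
  have ci := T.child_covBy r i
  have ck := T.child_covBy r k
  refine T.child_injective r ?_
  rcases T.le_total_of_between T.root _ _ v hi (T.le_root _) hk (T.le_root _) with h | h
  · by_contra hne
    exact ci.2 (lt_of_le_of_ne h hne) ck.1
  · by_contra hne
    exact ck.2 (lt_of_le_of_ne h (Ne.symm hne)) ci.1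

theorem exists_le_child [Finite V] (hr : r.1 = T.root) {v : V} (hv : v ≠ T.root) :
    ∃ i, v ≤ T.child r i := by
  obtain ⟨w, hvw, hw⟩ := exists_le_covBy_of_lt (lt_of_le_of_ne (T.le_root v) hv)
  have : w ∈ Set.range (T.child r) := by
    rw [T.range_child r, hr]; exact hw
  obtain ⟨i, rfl⟩ := this
  exact ⟨i, hvw⟩

theorem ne_root_of_le_child (hr : r.1 = T.root) {v : V} {i : Fin 3} (hi : v ≤ T.child r i) :
    v ≠ T.root := by
  rintro rfl
  have := (T.child_covBy r i).1
  rw [hr] at this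
  exact this.not_ge hi

/-- The non-terminal nodes are the root and those of the three branches. -/
noncomputable def nonterminalEquiv [Finite V] (hr : r.1 = T.root) :
    Option (Σ i, NonterminalNode (Set.Iic (T.child r i))) ≃ NonterminalNode V :=
  Equiv.ofBijective (fun o => o.elim r fun x => x.2.ofIic) <| by
    constructor
    · rintro (_ | ⟨i, u⟩) (_ | ⟨k, w⟩) h
      · rfl
      · exact absurd ((congrArg Subtype.val h).symm.trans hr)
          (T.ne_root_of_le_child r hr w.1.2)
      · exact absurd ((congrArg Subtype.val h).trans hr) (T.ne_root_of_le_child r hr u.1.2)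
      · have h' : u.1.1 = w.1.1 := congrArg Subtype.val h
        obtain rfl : i = k := T.eq_of_le_child r u.1.2 (h' ▸ w.1.2)
        have : u = w := Subtype.ext (Subtype.ext h')
        rw [this]
    · intro u
      by_cases hu : u.1 = T.root
      · exact ⟨none, Subtype.ext (hr.trans hu.symm)⟩
      · obtain ⟨i, hi⟩ := T.exists_le_child r hr hu
        obtain ⟨w, hw⟩ := u.2
        exact ⟨some ⟨i, ⟨⟨u.1, hi⟩, ⟨⟨w, hw.le.trans hi⟩, Set.Iic_covBy_iff.mpr hw⟩⟩⟩, rfl⟩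

/-- The terminal nodes are those of the three branches. -/
noncomputable def terminalEquiv [Finite V] (hr : r.1 = T.root) :
    (Σ i, TerminalNode (Set.Iic (T.child r i))) ≃ TerminalNode V :=
  Equiv.ofBijective (fun x => x.2.ofIic) <| by
    constructor
    · rintro ⟨i, u⟩ ⟨k, w⟩ h
      have h' : u.1.1 = w.1.1 := congrArg Subtype.val h
      obtain rfl : i = k := T.eq_of_le_child r u.1.2 (h' ▸ w.1.2)
      have : u = w := Subtype.ext (Subtype.ext h')
      rw [this]
    · intro u
      have hu : u.1 ≠ T.root := by
        intro h
        obtain ⟨w, hw⟩ := r.2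
        rw [hr, ← h] at hw
        exact u.2 w hw
      obtain ⟨i, hi⟩ := T.exists_le_child r hr hu
      exact ⟨⟨i, ⟨⟨u.1, hi⟩, fun w hw => u.2 w.1 (Set.Iic_covBy_iff.mp hw)⟩⟩, rfl⟩

theorem subsingleton_of_terminal_root [Finite V] (h : ∀ w, ¬ w ⋖ T.root) : Subsingleton V := by
  have : ∀ v, v = T.root := by
    intro v
    by_contra hv
    obtain ⟨w, -, hw⟩ := exists_le_covBy_of_lt (lt_of_le_of_ne (T.le_root v) hv)
    exact h w hw
  exact ⟨fun a b => (this a).trans (this b).symm⟩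

theorem card_nonterminal [Finite V] (hr : r.1 = T.root) :
    Fintype.card (NonterminalNode V) =
      1 + ∑ i, Fintype.card (NonterminalNode (Set.Iic (T.child r i))) := by
  rw [← Fintype.card_congr (T.nonterminalEquiv r hr), Fintype.card_option, Fintype.card_sigma,
    add_comm]

theorem card_terminal_eq_sum [Finite V] (hr : r.1 = T.root) :
    Fintype.card (TerminalNode V) =
      ∑ i, Fintype.card (TerminalNode (Set.Iic (T.child r i))) := by
  rw [← Fintype.card_congr (T.terminalEquiv r hr), Fintype.card_sigma]

theorem natCard_Iic_child_lt [Finite V] (hr : r.1 = T.root) (i : Fin 3) :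
    Nat.card (Set.Iic (T.child r i)) < Nat.card V := by
  exact Finite.card_subtype_lt (x := T.root)
    fun h => T.ne_root_of_le_child r hr (i := i) h rfl

end Decomposition

/-- Induction on trees, from the branches at the root. -/
theorem induction_on.{u}
    {motive : ∀ (V : Type u) [PartialOrder V] [Finite V], OrnamentedTree V → Prop}
    (terminal : ∀ (V : Type u) [PartialOrder V] [Finite V] [Subsingleton V] (T : OrnamentedTree V),
      motive V T)
    (node : ∀ (V : Type u) [PartialOrder V] [Finite V] (T : OrnamentedTree V)
      (r : NonterminalNode V), r.1 = T.root → (∀ i, motive _ (T.branch r i)) → motive V T)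
    (V : Type u) [PartialOrder V] [Finite V] (T : OrnamentedTree V) : motive V T := by
  suffices h : ∀ (n : ℕ) (V : Type u) [PartialOrder V] [Finite V] (T : OrnamentedTree V),
      Nat.card V = n → motive V T from h _ V T rfl
  intro n
  induction n using Nat.strong_induction_on with
  | _ n ih =>
    intro V _ _ T hn
    by_cases h : ∃ w, w ⋖ T.root
    · refine node V T ⟨T.root, h⟩ rfl fun i => ?_
      exact ih _ (hn ▸ T.natCard_Iic_child_lt ⟨T.root, h⟩ rfl i) _ _ rfl
    · push Not at h
      have := T.subsingleton_of_terminal_root h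
      exact terminal V T

/-- Converts bounds that are geometric in the number of non-terminal nodes into bounds geometric in
the number of leaves. -/
theorem card_terminal [Finite V] (T : OrnamentedTree V) :
    Fintype.card (TerminalNode V) = 2 * Fintype.card (NonterminalNode V) + 1 := by
  refine induction_on (motive := fun V _ _ _ => Fintype.card (TerminalNode V) =
    2 * Fintype.card (NonterminalNode V) + 1) ?_ ?_ V T
  · intro V _ _ _ T
    have h : ∀ v w : V, ¬ w ⋖ v := fun v w h => h.1.ne (Subsingleton.elim _ _)
    have h0 : IsEmpty (NonterminalNode V) := ⟨fun u => let ⟨w, hw⟩ := u.2; h _ _ hw⟩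
    rw [Fintype.card_eq_zero (α := NonterminalNode V), mul_zero, zero_add,
      Fintype.card_eq_one_iff]
    exact ⟨⟨T.root, h _⟩, fun y => Subtype.ext (Subsingleton.elim _ _)⟩
  · intro V _ _ T r hr ih
    rw [T.card_terminal_eq_sum r hr, T.card_nonterminal r hr, Finset.sum_congr rfl fun i _ => ih i]
    rw [Finset.sum_add_distrib, ← Finset.mul_sum]
    simp
    ring

/-- The index at the root and at its children. -/
def rootIndex (T : OrnamentedTree V) (r : NonterminalNode V) (j : V → ℤ) : ℤ × (Fin 3 → ℤ) :=
  (j r.1, fun i => j (T.child r i))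

theorem rootIndex_mem_nodeSet {T : OrnamentedTree V} (r : NonterminalNode V) {j : V → ℤ}
    (hj : j ∈ T.indexSet) : T.rootIndex r j ∈ nodeSet (r ∈ T.simple) :=
  ⟨hj.1 r, hj.2.1 r, hj.2.2 r⟩

theorem comp_val_mem_indexSet {T : OrnamentedTree V} (a : V) {j : V → ℤ} (hj : j ∈ T.indexSet) :
    (fun v : Set.Iic a => j v.1) ∈ (T.subtree a).indexSet :=
  ⟨fun v => hj.1 v.ofIic, fun v hv => hj.2.1 v.ofIic hv, fun v hv => hj.2.2 v.ofIic hv⟩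

theorem ext_of_branches [Finite V] (T : OrnamentedTree V) (r : NonterminalNode V)
    (hr : r.1 = T.root) {j j' : V → ℤ} (h0 : j T.root = j' T.root)
    (h : ∀ (i : Fin 3) (v : V), v ≤ T.child r i → j v = j' v) : j = j' := by
  funext v
  by_cases hv : v = T.root
  · rw [hv, h0]
  · obtain ⟨i, hi⟩ := T.exists_le_child r hr hv
    exact h i v hi

/-- An admissible index vector is determined by its values at the terminal nodes. -/
theorem injOn_indexSet [Finite V] (T : OrnamentedTree V) :
    Set.InjOn (fun (j : V → ℤ) (w : TerminalNode V) => j w.1) T.indexSet := by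
  refine induction_on (motive := fun V _ _ T =>
    Set.InjOn (fun (j : V → ℤ) (w : TerminalNode V) => j w.1) T.indexSet) ?_ ?_ V T
  · intro V _ _ _ T j _ j' _ h
    have h' : ∀ v w : V, ¬ w ⋖ v := fun v w h => h.1.ne (Subsingleton.elim _ _)
    exact funext fun v => congrFun h ⟨v, h' v⟩
  · intro V _ _ T r hr ih j hj j' hj' h
    have h1 : ∀ (i : Fin 3) (v : V), v ≤ T.child r i → j v = j' v := by
      intro i v hv
      have := ih i (comp_val_mem_indexSet _ hj) (comp_val_mem_indexSet _ hj')
        (funext fun w => congrFun h w.ofIic)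
      exact congrFun this ⟨v, hv⟩
    refine T.ext_of_branches r hr ?_ h1
    rw [← hr, hj.1 r, hj'.1 r, h1 0 _ le_rfl, h1 1 _ le_rfl, h1 2 _ le_rfl]

end OrnamentedTree

/-! ### Tree coefficients as iterated integrals. -/

namespace OrnamentedTree

variable {V : Type*} [PartialOrder V]

/-- The integrand of the tree coefficient at a single node. -/
noncomputable def nodeExp (T : OrnamentedTree V) (ω : ℝ) (j : V → ℤ) (u : NonterminalNode V)
    (s : ℝ) : ℂ :=
  Complex.exp (((T.sign u.1 : ℤ) : ℂ) * Complex.I * (ω : ℂ) * (T.nodeResonance j u : ℂ) * (s : ℂ))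

theorem norm_nodeExp (T : OrnamentedTree V) (ω : ℝ) (j : V → ℤ) (u : NonterminalNode V) (s : ℝ) :
    ‖T.nodeExp ω j u s‖ = 1 := by
  rw [nodeExp, show ((T.sign u.1 : ℤ) : ℂ) * Complex.I * (ω : ℂ) * (T.nodeResonance j u : ℂ) *
    (s : ℂ) = (((T.sign u.1 : ℤ) * ω * T.nodeResonance j u * s : ℝ) : ℂ) * Complex.I by
      push_cast; ring, Complex.norm_exp_ofReal_mul_I]

theorem continuous_nodeExp (T : OrnamentedTree V) (ω : ℝ) (j : V → ℤ) (u : NonterminalNode V) :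
    Continuous (T.nodeExp ω j u) := by
  unfold nodeExp; fun_prop

theorem nodeExp_eq (T : OrnamentedTree V) (r : NonterminalNode V) (o : ℤ) (j : V → ℤ) (s : ℝ) :
    T.nodeExp o j r s = Complex.exp (Complex.I *
      (nodePhase ((T.sign r.1 : ℤ) * o) (T.rootIndex r j) : ℤ) * s) := by
  rw [nodeExp, nodePhase, TernaryTree.nodeResonance, rootIndex]
  congr 1
  push_cast
  ring

theorem timeRegion_subset (T : OrnamentedTree V) (t : ℝ) :
    T.timeRegion t ⊆ Set.Icc 0 (fun _ => t) := fun _ hs =>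
  ⟨fun u => (hs u u le_rfl).1, fun u => (hs u u le_rfl).2.2⟩

theorem isClosed_timeRegion (T : OrnamentedTree V) (t : ℝ) : IsClosed (T.timeRegion t) := by
  have : T.timeRegion t = ⋂ (u : NonterminalNode V) (u' : NonterminalNode V) (_ : u.1 ≤ u'.1),
      {s : NonterminalNode V → ℝ | 0 ≤ s u} ∩ ({s | s u ≤ s u'} ∩ {s | s u' ≤ t}) := by
    ext s; simp [TernaryTree.timeRegion]
  rw [this]
  refine isClosed_iInter fun u => isClosed_iInter fun u' => isClosed_iInter fun _ => ?_
  refine (isClosed_le continuous_const (continuous_apply _)).inter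
    ((isClosed_le (continuous_apply u) (continuous_apply u')).inter
      (isClosed_le (continuous_apply _) continuous_const))

theorem isCompact_timeRegion (T : OrnamentedTree V) (t : ℝ) : IsCompact (T.timeRegion t) :=
  isCompact_Icc.of_isClosed_subset (T.isClosed_timeRegion t) (T.timeRegion_subset t)

variable [Finite V]

theorem treeCoeff_eq (T : OrnamentedTree V) (ω t : ℝ) (j : V → ℤ) :
    T.treeCoeff ω t j = ∫ s in T.timeRegion t, ∏ u, T.nodeExp ω j u (s u) := rfl

/-- The integrand is unimodular and the region lies in a cube of side `t`. All the smallness in `t`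
of the final estimate comes from here. -/
theorem norm_treeCoeff_le (T : OrnamentedTree V) (ω : ℝ) {t : ℝ} (ht : 0 ≤ t) (j : V → ℤ) :
    ‖T.treeCoeff ω t j‖ ≤ t ^ Fintype.card (NonterminalNode V) := by
  have h1 : volume (Set.Icc (0 : NonterminalNode V → ℝ) (fun _ => t)) =
      ENNReal.ofReal (t ^ Fintype.card (NonterminalNode V)) := by
    rw [Real.volume_Icc_pi, ENNReal.ofReal_pow ht]
    simp
  have h2 : volume (T.timeRegion t) ≤ ENNReal.ofReal (t ^ Fintype.card (NonterminalNode V)) :=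
    (measure_mono (T.timeRegion_subset t)).trans_eq h1
  rw [treeCoeff_eq]
  refine (norm_setIntegral_le_of_norm_le_const (C := 1) (h2.trans_lt ENNReal.ofReal_lt_top)
    fun s _ => ?_).trans ?_
  · rw [norm_prod]
    simp [norm_nodeExp]
  · rw [one_mul]
    exact ENNReal.toReal_le_of_le_ofReal (by positivity) h2

theorem treeCoeff_of_subsingleton [Subsingleton V] (T : OrnamentedTree V) (ω t : ℝ) (j : V → ℤ) :
    T.treeCoeff ω t j = 1 := by
  have h : ∀ v w : V, ¬ w ⋖ v := fun v w h => h.1.ne (Subsingleton.elim _ _)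
  have h0 : IsEmpty (NonterminalNode V) := ⟨fun u => let ⟨w, hw⟩ := u.2; h _ _ hw⟩
  have h1 : T.timeRegion t = Set.univ := Set.eq_univ_of_forall fun s u => h0.elim u
  rw [treeCoeff_eq, h1, Measure.restrict_univ, Measure.volume_pi_eq_dirac, integral_dirac]
  simp

section Branches

variable (T : OrnamentedTree V) (r : NonterminalNode V)

theorem nonterminal_cases (hr : r.1 = T.root) (u : NonterminalNode V) :
    u = r ∨ ∃ (i : Fin 3) (w : NonterminalNode (Set.Iic (T.child r i))), u = w.ofIic := by
  obtain ⟨o, rfl⟩ := (T.nonterminalEquiv r hr).surjective u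
  cases o with
  | none => exact Or.inl rfl
  | some x => exact Or.inr ⟨x.1, x.2, rfl⟩

/-- Nodes of different branches are incomparable, so the constraints link times only within a branch
or with the root. -/
theorem mem_timeRegion_iff (hr : r.1 = T.root) (t : ℝ) (s : NonterminalNode V → ℝ) :
    s ∈ T.timeRegion t ↔ s r ∈ Set.Icc 0 t ∧
      ∀ i, (fun u => s (NonterminalNode.ofIic u)) ∈ (T.branch r i).timeRegion (s r) := by
  constructor
  · intro h
    refine ⟨⟨(h r r le_rfl).1, (h r r le_rfl).2.2⟩, fun i u u' huu' => ?_⟩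
    have h1 := h u.ofIic u'.ofIic huu'
    exact ⟨h1.1, h1.2.1, (h u'.ofIic r (hr ▸ T.le_root _)).2.1⟩
  · rintro ⟨⟨h0, h1⟩, h2⟩ u u' huu'
    rcases T.nonterminal_cases r hr u' with rfl | ⟨i, w', rfl⟩
    · rcases T.nonterminal_cases u' hr u with rfl | ⟨i, w, rfl⟩
      · exact ⟨h0, le_rfl, h1⟩
      · have h3 := h2 i w w le_rfl
        exact ⟨h3.1, h3.2.2, h1⟩
    · rcases T.nonterminal_cases r hr u with rfl | ⟨k, w, rfl⟩
      · exact absurd ((T.le_root _).antisymm (hr ▸ huu')) (T.ne_root_of_le_child u hr w'.1.2)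
      · obtain rfl : k = i := T.eq_of_le_child r w.1.2 (huu'.trans w'.1.2)
        have h3 := h2 k w w' huu'
        exact ⟨h3.1, h3.2.1, h3.2.2.trans h1⟩

/-- Assembling times at the nodes of a tree from a time at the root and times in the branches. -/
noncomputable def joinTimes (hr : r.1 = T.root)
    (x : ℝ × (∀ i, NonterminalNode (Set.Iic (T.child r i)) → ℝ)) (u : NonterminalNode V) : ℝ :=
  ((T.nonterminalEquiv r hr).symm u).elim x.1 fun y => x.2 y.1 y.2

theorem joinTimes_root (hr : r.1 = T.root)
    (x : ℝ × (∀ i, NonterminalNode (Set.Iic (T.child r i)) → ℝ)) :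
    T.joinTimes r hr x r = x.1 := by
  have : (T.nonterminalEquiv r hr).symm r = none := (Equiv.symm_apply_eq _).mpr rfl
  rw [joinTimes, this]
  rfl

theorem joinTimes_ofIic (hr : r.1 = T.root)
    (x : ℝ × (∀ i, NonterminalNode (Set.Iic (T.child r i)) → ℝ)) (i : Fin 3)
    (u : NonterminalNode (Set.Iic (T.child r i))) :
    T.joinTimes r hr x u.ofIic = x.2 i u := by
  have : u.ofIic = T.nonterminalEquiv r hr (some ⟨i, u⟩) := rfl
  rw [joinTimes, this, Equiv.symm_apply_apply]
  rfl

theorem prod_nonterminal {M : Type*} [CommMonoid M] (hr : r.1 = T.root)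
    (f : NonterminalNode V → M) :
    ∏ u, f u = f r * ∏ i, ∏ u : NonterminalNode (Set.Iic (T.child r i)), f u.ofIic := by
  rw [← (T.nonterminalEquiv r hr).prod_comp, Fintype.prod_option, Fintype.prod_sigma]
  rfl

theorem measurable_joinTimes (hr : r.1 = T.root) : Measurable (T.joinTimes r hr) := by
  refine measurable_pi_lambda _ fun u => ?_
  unfold joinTimes
  cases (T.nonterminalEquiv r hr).symm u with
  | none => exact measurable_fst
  | some y =>
    exact (measurable_pi_apply y.2).comp ((measurable_pi_apply y.1).comp measurable_snd)

theorem map_joinTimes (hr : r.1 = T.root) :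
    Measure.map (T.joinTimes r hr) (volume : Measure (ℝ × (∀ i,
      NonterminalNode (Set.Iic (T.child r i)) → ℝ))) = volume := by
  symm
  refine Measure.pi_eq fun S hS => ?_
  rw [Measure.map_apply (T.measurable_joinTimes r hr) (MeasurableSet.univ_pi hS)]
  have : T.joinTimes r hr ⁻¹' (Set.univ.pi S) = S r ×ˢ (Set.univ.pi fun i =>
      Set.univ.pi fun u : NonterminalNode (Set.Iic (T.child r i)) => S u.ofIic) := by
    ext x
    simp only [Set.mem_preimage, Set.mem_pi, Set.mem_univ, true_imp_iff, Set.mem_prod]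
    constructor
    · intro h
      refine ⟨?_, fun i u => ?_⟩
      · rw [← T.joinTimes_root r hr x]; exact h r
      · rw [← T.joinTimes_ofIic r hr x]; exact h _
    · rintro ⟨h1, h2⟩ u
      rcases T.nonterminal_cases r hr u with rfl | ⟨i, w, rfl⟩
      · rw [joinTimes_root]; exact h1
      · rw [joinTimes_ofIic]; exact h2 i w
  rw [this, Measure.volume_eq_prod, Measure.prod_prod, volume_pi, Measure.pi_pi,
    T.prod_nonterminal r hr]
  congr 1
  refine Finset.prod_congr rfl fun i _ => ?_
  rw [volume_pi, Measure.pi_pi]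

/-- Fubini with the root time outermost: once it is fixed, the branches decouple and the inner
integral is a product. -/
theorem treeCoeff_eq_integral (hr : r.1 = T.root) (ω : ℝ) {t : ℝ} (ht : 0 ≤ t) (j : V → ℤ) :
    T.treeCoeff ω t j = ∫ s in (0 : ℝ)..t, T.nodeExp ω j r s *
      ∏ i, (T.branch r i).treeCoeff ω s (fun v => j v.1) := by
  set F : (NonterminalNode V → ℝ) → ℂ :=
    (T.timeRegion t).indicator fun s => ∏ u, T.nodeExp ω j u (s u) with hF
  have hFint : Integrable F := by
    rw [hF, integrable_indicator_iff (T.isClosed_timeRegion t).measurableSet]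
    refine ContinuousOn.integrableOn_compact (T.isCompact_timeRegion t) ?_
    refine Continuous.continuousOn (continuous_finsetProd _ fun u _ => ?_)
    exact (T.continuous_nodeExp ω j u).comp (continuous_apply u)
  have hmeas := T.measurable_joinTimes r hr
  have hFj : Integrable (fun x => F (T.joinTimes r hr x)) := by
    have := hFint
    rw [← T.map_joinTimes r hr] at this
    exact this.comp_measurable hmeas
  have hval : ∀ x, F (T.joinTimes r hr x) = (Set.Icc 0 t).indicator (T.nodeExp ω j r) x.1 *
      ∏ i, ((T.branch r i).timeRegion x.1).indicator
        (fun s => ∏ u, (T.branch r i).nodeExp ω (fun v => j v.1) u (s u)) (x.2 i) := by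
    intro x
    have hmem := T.mem_timeRegion_iff r hr t (T.joinTimes r hr x)
    simp only [joinTimes_root, joinTimes_ofIic] at hmem
    by_cases h : T.joinTimes r hr x ∈ T.timeRegion t
    · obtain ⟨h1, h2⟩ := hmem.mp h
      rw [hF, Set.indicator_of_mem h, Set.indicator_of_mem h1, T.prod_nonterminal r hr,
        joinTimes_root]
      congr 1
      refine Finset.prod_congr rfl fun i _ => ?_
      rw [Set.indicator_of_mem (h2 i)]
      refine Finset.prod_congr rfl fun u _ => ?_
      rw [joinTimes_ofIic]
      rfl
    · rw [hF, Set.indicator_of_notMem h]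
      by_cases h1 : x.1 ∈ Set.Icc 0 t
      · have : ∃ i, x.2 i ∉ (T.branch r i).timeRegion x.1 := by
          by_contra hc
          push Not at hc
          exact h (hmem.mpr ⟨h1, hc⟩)
        obtain ⟨i, hi⟩ := this
        rw [Finset.prod_eq_zero (Finset.mem_univ i), mul_zero]
        rw [Set.indicator_of_notMem hi]
      · rw [Set.indicator_of_notMem h1, zero_mul]
  rw [treeCoeff_eq, ← integral_indicator (T.isClosed_timeRegion t).measurableSet, ← hF,
    ← T.map_joinTimes r hr, integral_map hmeas.aemeasurable
      (by rw [T.map_joinTimes r hr]; exact hFint.aestronglyMeasurable)]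
  rw [Measure.volume_eq_prod, integral_prod _ (by rw [← Measure.volume_eq_prod]; exact hFj)]
  rw [intervalIntegral.integral_of_le ht, ← integral_Icc_eq_integral_Ioc,
    ← integral_indicator measurableSet_Icc]
  congr 1
  funext s
  simp_rw [hval]
  rw [integral_const_mul, integral_fintype_prod_volume_eq_prod]
  by_cases hs : s ∈ Set.Icc 0 t
  · rw [Set.indicator_of_mem hs, Set.indicator_of_mem hs]
    congr 1
    refine Finset.prod_congr rfl fun i _ => ?_
    rw [treeCoeff_eq, integral_indicator ((T.branch r i).isClosed_timeRegion s).measurableSet]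
  · rw [Set.indicator_of_notMem hs, Set.indicator_of_notMem hs, zero_mul]

end Branches

end OrnamentedTree

/-! ### Sums of products and Hölder's inequality for series. -/

theorem tsum_pi_fin_prod {n : ℕ} {α : Fin n → Type*} (f : ∀ i, α i → ENNReal) :
    ∑' x : ∀ i, α i, ∏ i, f i (x i) = ∏ i, ∑' a, f i a := by
  induction n with
  | zero => simp
  | succ n ih =>
    rw [← (Fin.consEquiv α).tsum_eq, ENNReal.tsum_prod', Fin.prod_univ_succ, ← ih,
      ← ENNReal.tsum_mul_right]
    refine tsum_congr fun a => ?_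
    rw [← ENNReal.tsum_mul_left]
    refine tsum_congr fun x => ?_
    simp [Fin.consEquiv, Fin.prod_univ_succ]

theorem tsum_pi_prod {ι α : Type*} [Fintype ι] (f : ι → α → ENNReal) :
    ∑' x : ι → α, ∏ i, f i (x i) = ∏ i, ∑' a, f i a := by
  let e := Fintype.equivFin ι
  rw [← (e.arrowCongr (Equiv.refl α)).symm.tsum_eq, ← e.symm.prod_comp, ← tsum_pi_fin_prod]
  refine tsum_congr fun x => ?_
  rw [← e.symm.prod_comp]
  simp [Equiv.arrowCongr]

theorem tsum_prod_rpow_le {α ι : Type*} (s : Finset ι) (f : ι → α → ENNReal) (p : ι → ℝ)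
    (hp : ∑ i ∈ s, p i = 1) (h2p : ∀ i ∈ s, 0 ≤ p i) :
    ∑' a, ∏ i ∈ s, f i a ^ p i ≤ ∏ i ∈ s, (∑' a, f i a) ^ p i := by
  let _ : MeasurableSpace α := ⊤
  have h := ENNReal.lintegral_prod_norm_pow_le (μ := Measure.count) s (f := f)
    (fun i _ => (measurable_from_top (f := f i)).aemeasurable) hp h2p
  simpa only [lintegral_count] using h

theorem tsum_rpow_mul_rpow_le {α : Type*} (f g : α → ENNReal) {p r : ℝ} (hp : 0 ≤ p) (hr : 0 ≤ r)
    (hpr : p + r = 1) :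
    ∑' a, f a ^ p * g a ^ r ≤ (∑' a, f a) ^ p * (∑' a, g a) ^ r := by
  let _ : MeasurableSpace α := ⊤
  have h := ENNReal.lintegral_mul_norm_pow_le (μ := Measure.count) (f := f) (g := g)
    (measurable_from_top (f := f)).aemeasurable (measurable_from_top (f := g)).aemeasurable
    hp hr hpr
  simpa only [lintegral_count] using h

/-- Summation over triples grouped by the values of maps to the integers. -/
theorem tsum_pi_fin_three_fiberwise {α : Fin 3 → Type*} (rt : ∀ i, α i → ℤ)
    (f : ∀ i, α i → ℤ → ENNReal) (K : (Fin 3 → ℤ) → (Fin 3 → ℤ) → ENNReal) :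
    ∑' (x : ∀ i, α i) (y : Fin 3 → ℤ), (∏ i, f i (x i) (y i)) * K (fun i => rt i (x i)) y =
      ∑' (q : Fin 3 → ℤ) (y : Fin 3 → ℤ),
        (∏ i, ∑' a : α i, ind (rt i a = q i) * f i a (y i)) * K q y := by
  have h1 : ∀ (x : ∀ i, α i) (q : Fin 3 → ℤ),
      ind ((fun i => rt i (x i)) = q) = ∏ i, ind (rt i (x i) = q i) := by
    intro x q
    by_cases h : (fun i => rt i (x i)) = q
    · rw [ind_of h, Finset.prod_eq_one]
      intro i _
      exact ind_of (congrFun h i)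
    · rw [ind_of_not h]
      obtain ⟨i, hi⟩ := Function.ne_iff.mp h
      exact (Finset.prod_eq_zero (Finset.mem_univ i) (ind_of_not hi)).symm
  have h2 : ∀ x : ∀ i, α i, ∑' y : Fin 3 → ℤ,
      (∏ i, f i (x i) (y i)) * K (fun i => rt i (x i)) y =
      ∑' (q : Fin 3 → ℤ) (y : Fin 3 → ℤ),
        (∏ i, ind (rt i (x i) = q i) * f i (x i) (y i)) * K q y := by
    intro x
    rw [← tsum_ind_eq_mul (fun i => rt i (x i))
      (fun q => ∑' y : Fin 3 → ℤ, (∏ i, f i (x i) (y i)) * K q y)]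
    refine tsum_congr fun q => ?_
    rw [← ENNReal.tsum_mul_left]
    refine tsum_congr fun y => ?_
    rw [h1, Finset.prod_mul_distrib, mul_assoc]
  simp_rw [h2]
  rw [ENNReal.tsum_comm]
  refine tsum_congr fun q => ?_
  rw [ENNReal.tsum_comm]
  refine tsum_congr fun y => ?_
  rw [ENNReal.tsum_mul_right,
    tsum_pi_fin_prod (fun i (a : α i) => ind (rt i a = q i) * f i a (y i))]

theorem hasSum_pi_fin_prod {n : ℕ} (f : Fin n → ℤ → ℂ) (hf : ∀ i, Summable fun a => ‖f i a‖) :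
    (Summable fun x : Fin n → ℤ => ‖∏ i, f i (x i)‖) ∧
      HasSum (fun x : Fin n → ℤ => ∏ i, f i (x i)) (∏ i, ∑' a, f i a) := by
  induction n with
  | zero =>
    simp only [Finset.univ_eq_empty, Finset.prod_empty]
    exact ⟨(hasSum_unique _).summable, hasSum_unique fun _ : Fin 0 → ℤ => (1 : ℂ)⟩
  | succ n ih =>
    obtain ⟨h1, h2⟩ := ih (fun i => f i.succ) fun i => hf i.succ
    have e : ∀ x : ℤ × (Fin n → ℤ),
        ∏ i, f i ((Fin.consEquiv fun _ : Fin (n + 1) => ℤ) x i) =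
          f 0 x.1 * ∏ i, f i.succ (x.2 i) := by
      intro x; simp [Fin.consEquiv, Fin.prod_univ_succ]
    have h3 := (hf 0).mul_norm h1
    constructor
    · rw [← (Fin.consEquiv fun _ : Fin (n + 1) => ℤ).summable_iff]
      refine h3.congr fun x => ?_
      simp only [Function.comp, e]
    · rw [← (Fin.consEquiv fun _ : Fin (n + 1) => ℤ).hasSum_iff, Fin.prod_univ_succ]
      refine ((hf 0).of_norm.hasSum.mul h2 h3.of_norm).congr_fun fun x => ?_
      simp only [Function.comp, e]

/-! ### Fourier series at a node. -/

/-- The coefficients of the solution at a node, in terms of those at the three children and of the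
phase at the node. -/
noncomputable def nodeCoeff (φ : ℤ) (c : Fin 3 → ℤ → ℂ) (τ : ℤ) : ℂ :=
  ∑' y : Fin 3 → ℤ, (∏ i, c i (y i)) * fourierKernel (φ + ∑ i, y i) τ

theorem enorm_nodeCoeff_le (φ : ℤ) (c : Fin 3 → ℤ → ℂ) (τ : ℤ) :
    ‖nodeCoeff φ c τ‖ₑ ≤ ∑' y : Fin 3 → ℤ, (∏ i, ‖c i (y i)‖ₑ) *
      ‖fourierKernel (φ + ∑ i, y i) τ‖ₑ := by
  refine enorm_tsum_le_tsum_enorm.trans_eq (tsum_congr fun y => ?_)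
  rw [enorm_mul]
  congr 1
  simp only [enorm_eq_nnnorm, nnnorm_prod, ENNReal.ofNNReal_finsetProd]

/-- The absolute convergence that permits interchanging the sums over incoming and outgoing
frequencies. -/
theorem summable_node (φ : ℤ) {c : Fin 3 → ℤ → ℂ} (hc : ∀ i, Summable fun τ => ‖c i τ‖) (t : ℝ) :
    Summable fun x : (Fin 3 → ℤ) × ℤ => (∏ i, c i (x.1 i)) *
      (fourierKernel (φ + ∑ i, x.1 i) x.2 * Complex.exp (Complex.I * x.2 * t)) := by
  refine Summable.of_enorm ?_
  obtain ⟨C, hC, h⟩ := tsum_kernelWeight_mul_le le_rfl zero_lt_one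
  have h1 : ∀ x : (Fin 3 → ℤ) × ℤ, ‖(∏ i, c i (x.1 i)) *
      (fourierKernel (φ + ∑ i, x.1 i) x.2 * Complex.exp (Complex.I * x.2 * t))‖ₑ ≤
      (∏ i, ‖c i (x.1 i)‖ₑ) * (4 * kernelWeight (φ + ∑ i, x.1 i) x.2) := by
    intro x
    rw [enorm_mul, enorm_mul]
    have e1 : ‖∏ i, c i (x.1 i)‖ₑ = ∏ i, ‖c i (x.1 i)‖ₑ := by
      simp only [enorm_eq_nnnorm, nnnorm_prod, ENNReal.ofNNReal_finsetProd]
    have e2 : ‖Complex.exp (Complex.I * x.2 * t)‖ₑ = 1 := by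
      rw [← ofReal_norm, show Complex.I * (x.2 : ℂ) * (t : ℂ) = ((x.2 * t : ℝ) : ℂ) * Complex.I by
        push_cast; ring, Complex.norm_exp_ofReal_mul_I, ENNReal.ofReal_one]
    rw [e1, e2, mul_one]
    gcongr
    refine (enorm_fourierKernel_le _ _).trans ?_
    gcongr
    refine mul_le_of_le_one_left zero_le ?_
    simpa using bracket_rpow_mono (φ + ∑ i, x.1 i) (show (-1 : ℝ) ≤ 0 by norm_num)
  refine ne_top_of_le_ne_top ?_ (ENNReal.tsum_le_tsum h1)
  rw [ENNReal.tsum_prod']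
  have h2 : ∀ y : Fin 3 → ℤ, ∑' τ : ℤ, (∏ i, ‖c i (y i)‖ₑ) *
      (4 * kernelWeight (φ + ∑ i, y i) τ) ≤ (∏ i, ‖c i (y i)‖ₑ) * (4 * C) := by
    intro y
    rw [ENNReal.tsum_mul_left, ENNReal.tsum_mul_left]
    gcongr
    simpa using h (φ + ∑ i, y i)
  refine ne_top_of_le_ne_top ?_ (ENNReal.tsum_le_tsum h2)
  rw [ENNReal.tsum_mul_right, tsum_pi_prod (fun i a => ‖c i a‖ₑ)]
  refine ENNReal.mul_ne_top (ENNReal.prod_ne_top fun i _ => ?_) (ENNReal.mul_ne_top (by simp) hC)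
  exact tsum_enorm_ne_top_iff_summable_norm.mpr (hc i)

theorem summable_nodeCoeff (φ : ℤ) {c : Fin 3 → ℤ → ℂ} (hc : ∀ i, Summable fun τ => ‖c i τ‖) :
    Summable fun τ => ‖nodeCoeff φ c τ‖ := by
  have h := (tsum_enorm_ne_top_iff_summable_norm.mpr (summable_node φ hc 0).norm)
  refine tsum_enorm_ne_top_iff_summable_norm.mp (ne_top_of_le_ne_top h ?_)
  rw [ENNReal.tsum_prod', ENNReal.tsum_comm]
  refine ENNReal.tsum_le_tsum fun τ => enorm_tsum_le_tsum_enorm.trans_eq (tsum_congr fun y => ?_)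
  simp

/-- The Fourier expansion of the time integral at a node. -/
theorem integral_node_eq_tsum (φ : ℤ) {c : Fin 3 → ℤ → ℂ} (hc : ∀ i, Summable fun τ => ‖c i τ‖)
    {t : ℝ} (ht : t ∈ Set.Icc (0 : ℝ) 1) :
    ∫ s in (0 : ℝ)..t, Complex.exp (Complex.I * φ * s) *
      ∏ i, ∑' τ, c i τ * Complex.exp (Complex.I * τ * s) =
      ∑' τ, nodeCoeff φ c τ * Complex.exp (Complex.I * τ * t) := by
  have hexp : ∀ (n : ℤ) (s : ℝ), ‖Complex.exp (Complex.I * n * s)‖ = 1 := by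
    intro n s
    rw [show Complex.I * (n : ℂ) * (s : ℂ) = ((n * s : ℝ) : ℂ) * Complex.I by
        push_cast; ring, Complex.norm_exp_ofReal_mul_I]
  have hc' : ∀ (s : ℝ) (i : Fin 3),
      Summable fun τ : ℤ => ‖c i τ * Complex.exp (Complex.I * τ * s)‖ := by
    intro s i
    simpa only [norm_mul, hexp, mul_one] using hc i
  have hprod := fun s : ℝ =>
    (hasSum_pi_fin_prod (fun i τ => c i τ * Complex.exp (Complex.I * τ * s)) (hc' s)).2
  have hterm : ∀ (s : ℝ) (y : Fin 3 → ℤ), Complex.exp (Complex.I * φ * s) *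
      ∏ i, (c i (y i) * Complex.exp (Complex.I * (y i : ℤ) * s)) =
      (∏ i, c i (y i)) * Complex.exp (Complex.I * (φ + ∑ i, y i : ℤ) * s) := by
    intro s y
    rw [Finset.prod_mul_distrib, ← Complex.exp_sum, mul_left_comm, ← Complex.exp_add]
    congr 2
    push_cast
    rw [mul_add, add_mul, Finset.mul_sum, Finset.sum_mul]
  have hint : HasSum (fun y : Fin 3 → ℤ => ∫ s in (0 : ℝ)..t, (∏ i, c i (y i)) *
      Complex.exp (Complex.I * (φ + ∑ i, y i : ℤ) * s))
      (∫ s in (0 : ℝ)..t, Complex.exp (Complex.I * φ * s) *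
      ∏ i, ∑' τ, c i τ * Complex.exp (Complex.I * τ * s)) := by
    refine intervalIntegral.hasSum_integral_of_dominated_convergence
      (fun y _ => ‖∏ i, c i (y i)‖) (fun y => ?_) (fun y => ?_) ?_ ?_ ?_
    · exact Continuous.aestronglyMeasurable (by fun_prop)
    · refine Filter.Eventually.of_forall fun s _ => ?_
      rw [norm_mul, hexp, mul_one]
    · exact Filter.Eventually.of_forall fun s _ => (hasSum_pi_fin_prod c hc).1
    · exact intervalIntegrable_const
    · refine Filter.Eventually.of_forall fun s _ => ?_
      refine ((hprod s).mul_left _).congr_fun fun y => ?_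
      exact (hterm s y).symm
  rw [← hint.tsum_eq]
  have hs := summable_node φ hc t
  have h1 : ∀ y : Fin 3 → ℤ, ∫ s in (0 : ℝ)..t, (∏ i, c i (y i)) *
      Complex.exp (Complex.I * (φ + ∑ i, y i : ℤ) * s) = ∑' τ : ℤ, (∏ i, c i (y i)) *
      (fourierKernel (φ + ∑ i, y i) τ * Complex.exp (Complex.I * τ * t)) := by
    intro y
    rw [intervalIntegral.integral_const_mul, ← (hasSum_fourierKernel _ ht).tsum_eq, tsum_mul_left]
  rw [tsum_congr h1]
  have hs2 : Summable (Function.uncurry fun (y : Fin 3 → ℤ) (τ : ℤ) => (∏ i, c i (y i)) *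
      (fourierKernel (φ + ∑ i, y i) τ * Complex.exp (Complex.I * τ * t))) := hs
  rw [← hs2.tsum_comm]
  refine tsum_congr fun τ => ?_
  rw [nodeCoeff, ← tsum_mul_right]
  exact tsum_congr fun y => by ring

/-- Hölder's inequality for the coefficients at a node. -/
theorem enorm_nodeCoeff_le_rpow (φ : ℤ) {c : Fin 3 → ℤ → ℂ} {w b : Fin 3 → ℤ → ENNReal} {s : ℝ}
    (hs : 1 ≤ s) (h : ∀ i τ, ‖c i τ‖ₑ ≤ w i τ ^ (1 - 1 / s) * b i τ ^ (1 / s)) (τ : ℤ) :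
    ‖nodeCoeff φ c τ‖ₑ ≤
      (∑' y : Fin 3 → ℤ, (∏ i, w i (y i)) * (4 * kernelWeight (φ + ∑ i, y i) τ)) ^ (1 - 1 / s) *
      (∑' y : Fin 3 → ℤ, (∏ i, b i (y i)) * (4 * (bracket (φ + ∑ i, y i) ^ (-s) *
        kernelWeight (φ + ∑ i, y i) τ))) ^ (1 / s) := by
  have hs0 : 0 < s := by linarith
  have h0 : 0 ≤ 1 / s := by positivity
  have h0' : 0 ≤ 1 - 1 / s := by
    rw [sub_nonneg, div_le_one hs0]; exact hs
  refine (enorm_nodeCoeff_le φ c τ).trans (le_trans (ENNReal.tsum_le_tsum fun y => ?_)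
    (tsum_rpow_mul_rpow_le _ _ h0' h0 (by ring)))
  set ρ := φ + ∑ i, y i
  have e1 : ∏ i, ‖c i (y i)‖ₑ ≤ (∏ i, w i (y i)) ^ (1 - 1 / s) * (∏ i, b i (y i)) ^ (1 / s) := by
    rw [← ENNReal.prod_rpow_of_nonneg h0', ← ENNReal.prod_rpow_of_nonneg h0,
      ← Finset.prod_mul_distrib]
    exact Finset.prod_le_prod' fun i _ => h i (y i)
  -- The whole factor `⟨ρ⟩⁻¹` is given to the second factor, where it becomes the summable `⟨ρ⟩ ^
  -- (-s)`.
  have e2 : (4 * kernelWeight ρ τ) ^ (1 - 1 / s) *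
      (4 * (bracket ρ ^ (-s) * kernelWeight ρ τ)) ^ (1 / s) =
      4 * (bracket ρ ^ (-1 : ℝ) * kernelWeight ρ τ) := by
    rw [mul_left_comm 4, ENNReal.mul_rpow_of_nonneg _ (4 * _) h0, mul_left_comm,
      ← ENNReal.rpow_add_of_nonneg _ _ h0' h0, ← ENNReal.rpow_mul]
    rw [show 1 - 1 / s + 1 / s = 1 by ring, ENNReal.rpow_one, show -s * (1 / s) = -1 by
      field_simp]
    ring
  calc _ ≤ ((∏ i, w i (y i)) ^ (1 - 1 / s) * (∏ i, b i (y i)) ^ (1 / s)) *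
        (4 * (bracket ρ ^ (-1 : ℝ) * kernelWeight ρ τ)) :=
        mul_le_mul' e1 (enorm_fourierKernel_le _ _)
    _ = _ := by
        rw [← e2, ENNReal.mul_rpow_of_nonneg (∏ i, w i (y i)) _ h0',
          ENNReal.mul_rpow_of_nonneg (∏ i, b i (y i)) _ h0]
        ring

/-! ### The interpolated majorant, by induction on the tree. -/

namespace OrnamentedTree

/-- Fourier coefficients of the tree coefficients, with an interpolated majorant: `b` is controlled
after summation over the admissible indices, `w` pointwise in the index. -/
structure TreeMajorant {V : Type*} [PartialOrder V] [Finite V] (T : OrnamentedTree V)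
    (A : ENNReal) (κ ε s : ℝ) (o : ℤ) where
  c : (V → ℤ) → ℤ → ℂ
  w : (V → ℤ) → ℤ → ENNReal
  b : (V → ℤ) → ℤ → ENNReal
  summable : ∀ j, Summable fun τ => ‖c j τ‖
  treeCoeff_eq : ∀ j, ∀ t ∈ Set.Icc (0 : ℝ) 1,
    T.treeCoeff o t j = ∑' τ, c j τ * Complex.exp (Complex.I * τ * t)
  enorm_le : ∀ j ∈ T.indexSet, ∀ τ, ‖c j τ‖ₑ ≤ w j τ ^ (1 - 1 / s) * b j τ ^ (1 / s)
  tsum_w_le : ∀ j, ∑' τ, w j τ ≤ A ^ Fintype.card (NonterminalNode V)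
  -- The next two bounds sustain each other: the leaf bound at a node uses the leaf bound in the
  -- branch containing the leaf and the root bound in the other two.
  tsum_root_le : ∀ n τ, ∑' j, ind (j T.root = n) * b j τ ≤
    A ^ Fintype.card (NonterminalNode V) * bracket τ ^ (-κ)
  tsum_leaf_le : ∀ (u : TerminalNode V) (z : ℤ),
    ∑' j, ind (j u.1 = z) * ∑' τ, bracket τ ^ ε * b j τ ≤
      A ^ Fintype.card (NonterminalNode V)

/-- The majorant of a tree with a single node. -/
noncomputable def TreeMajorant.ofSubsingleton {V : Type*} [PartialOrder V] [Finite V]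
    [Subsingleton V] (T : OrnamentedTree V) (A : ENNReal) {κ ε s : ℝ} (hs : 1 ≤ s) (o : ℤ) :
    TreeMajorant T A κ ε s o := by
  have h : ∀ v w : V, ¬ w ⋖ v := fun v w h => h.1.ne (Subsingleton.elim _ _)
  have h0 : IsEmpty (NonterminalNode V) := ⟨fun u => let ⟨w, hw⟩ := u.2; h _ _ hw⟩
  have hcard : Fintype.card (NonterminalNode V) = 0 := Fintype.card_eq_zero
  have hinj : ∀ (v : V) (z : ℤ), Set.InjOn (fun _ : V → ℤ => ()) {j | j v = z} := by
    intro v z j hj j' hj' _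
    funext u
    rw [Subsingleton.elim u v]
    exact hj.trans hj'.symm
  have hs0 : 0 < s := by linarith
  have h0' : 0 ≤ 1 - 1 / s := by
    rw [sub_nonneg, div_le_one hs0]; exact hs
  refine ⟨fun _ τ => if τ = 0 then 1 else 0, fun _ τ => ind (0 = τ), fun _ τ => ind (0 = τ),
    ?_, ?_, ?_, ?_, ?_, ?_⟩
  · intro j
    refine summable_of_ne_finset_zero (s := {0}) fun τ hτ => ?_
    simp at hτ
    simp [hτ]
  · intro j t ht
    rw [treeCoeff_of_subsingleton, tsum_eq_single 0]
    · simp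
    · intro τ hτ; simp [hτ]
  · intro j _ τ
    by_cases hτ : τ = 0
    · subst hτ; simp [ind]
    · simp [hτ]
  · intro j
    have := tsum_ind_eq_mul (0 : ℤ) fun _ => 1
    simp only [mul_one] at this
    rw [this, hcard, pow_zero]
  · intro n τ
    refine (tsum_ind_mul_le_of_injOn (hinj T.root n) (G := fun _ => bracket τ ^ (-κ))
      fun j _ => ?_).trans ?_
    · by_cases hτ : 0 = τ
      · subst hτ; simp [ind]
      · rw [ind_of_not hτ]; exact zero_le
    · simp
  · intro u z
    refine (tsum_ind_mul_le_of_injOn (hinj u.1 z) (G := fun _ => 1) fun j _ => ?_).trans ?_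
    · have := tsum_ind_eq_mul (0 : ℤ) fun τ => bracket τ ^ ε
      simp_rw [mul_comm (ind _)] at this
      rw [this]
      simp
    · simp

section Node

variable {V : Type*} [PartialOrder V] [Finite V] (T : OrnamentedTree V) (r : NonterminalNode V)

theorem injective_root_branches (hr : r.1 = T.root) : Function.Injective
    (fun j : V → ℤ => ((j T.root, fun _ v => j v.1) :
      ℤ × ∀ i, Set.Iic (T.child r i) → ℤ)) := by
  intro j j' h
  obtain ⟨h1, h2⟩ := Prod.mk.inj h
  exact T.ext_of_branches r hr h1 fun i v hv => congrFun (congrFun h2 i) ⟨v, hv⟩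

/-- Index vectors are split into the branches and grouped by the values at the three children; the
root bounds of the branches are then the input of the estimate `hC` at one node. -/
theorem tsum_branches_root_le {κ ε s : ℝ} {A : ENNReal} {o : ℤ} (hr : r.1 = T.root)
    (M : ∀ i, TreeMajorant (T.branch r i) A κ ε s o) {C : ENNReal} (hCA : 4 * C ≤ A)
    (hC : ∀ (simple : Prop) (sg : ℤ) (_ : sg ≠ 0) (n τ : ℤ)
      (β : Fin 3 → ℤ → ℤ → ENNReal) (B : Fin 3 → ENNReal),
      (∀ i m σ, β i m σ ≤ B i * bracket σ ^ (-κ)) →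
      ∑' (q : Fin 3 → ℤ) (y : Fin 3 → ℤ), ind ((n, q) ∈ nodeSet simple) *
        ((∏ i, β i (q i) (y i)) * (bracket (nodePhase sg (n, q) + ∑ i, y i) ^ (-s) *
          kernelWeight (nodePhase sg (n, q) + ∑ i, y i) τ)) ≤
        C * (∏ i, B i) * bracket τ ^ (-κ))
    {sg : ℤ} (hsg : sg ≠ 0) (n τ : ℤ) :
    ∑' j, ind (j T.root = n) * (ind (T.rootIndex r j ∈ nodeSet (r ∈ T.simple)) *
      ∑' y : Fin 3 → ℤ, (∏ i, (M i).b (fun v => j v.1) (y i)) *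
        (4 * (bracket (nodePhase sg (T.rootIndex r j) + ∑ i, y i) ^ (-s) *
          kernelWeight (nodePhase sg (T.rootIndex r j) + ∑ i, y i) τ))) ≤
      A ^ Fintype.card (NonterminalNode V) * bracket τ ^ (-κ) := by
  set K : (Fin 3 → ℤ) → (Fin 3 → ℤ) → ENNReal := fun q y =>
    ind ((n, q) ∈ nodeSet (r ∈ T.simple)) *
      (4 * (bracket (nodePhase sg (n, q) + ∑ i, y i) ^ (-s) *
        kernelWeight (nodePhase sg (n, q) + ∑ i, y i) τ)) with hK
  have hinj : Set.InjOn (fun (j : V → ℤ) (i : Fin 3) (v : Set.Iic (T.child r i)) => j v.1)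
      {j | j T.root = n} := by
    intro j hj j' hj' h
    exact T.injective_root_branches r hr (Prod.ext (hj.trans hj'.symm) h)
  refine (tsum_ind_mul_le_of_injOn hinj (G := fun J : ∀ i, Set.Iic (T.child r i) → ℤ =>
    ∑' y : Fin 3 → ℤ, (∏ i, (M i).b (J i) (y i)) * K (fun i => J i ⟨T.child r i, le_rfl⟩) y)
    fun j hj => ?_).trans ?_
  · have e : T.rootIndex r j = (n, fun i => j (T.child r i)) := by
      rw [rootIndex, hr]; exact congrArg (·, _) hj
    rw [e, ← ENNReal.tsum_mul_left]
    refine le_of_eq (tsum_congr fun y => ?_)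
    rw [hK]
    ring
  · rw [tsum_pi_fin_three_fiberwise (fun i (a : Set.Iic (T.child r i) → ℤ) => a ⟨_, le_rfl⟩)
      (fun i => (M i).b) K]
    refine le_trans (le_of_eq ?_) (le_trans (mul_le_mul_right (hC (r ∈ T.simple) sg hsg n τ
      (fun i m σ => ∑' a : Set.Iic (T.child r i) → ℤ, ind (a ⟨_, le_rfl⟩ = m) * (M i).b a σ)
      (fun i => A ^ Fintype.card (NonterminalNode (Set.Iic (T.child r i))))
      (fun i m σ => (M i).tsum_root_le m σ)) 4) ?_)
    · rw [← ENNReal.tsum_mul_left]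
      refine tsum_congr fun q => ?_
      rw [← ENNReal.tsum_mul_left]
      refine tsum_congr fun y => ?_
      rw [hK]
      ring
    · rw [T.card_nonterminal r hr, pow_add, pow_one, Finset.prod_pow_eq_pow_sum, ← mul_assoc,
        ← mul_assoc]
      gcongr

theorem tsum_branches_leaf_le {κ ε s : ℝ} {A : ENNReal} {o : ℤ} (hr : r.1 = T.root)
    (M : ∀ i, TreeMajorant (T.branch r i) A κ ε s o) {C : ENNReal} (hCA : 4 * C ≤ A)
    (hC : ∀ (simple : Prop) (sg : ℤ) (_ : sg ≠ 0) (i₀ : Fin 3)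
      (β : Fin 3 → ℤ → ℤ → ENNReal) (B : Fin 3 → ENNReal),
      (∀ i, i ≠ i₀ → ∀ m σ, β i m σ ≤ B i * bracket σ ^ (-κ)) →
      (∑' (m : ℤ) (σ : ℤ), β i₀ m σ * bracket σ ^ ε ≤ B i₀) →
      ∑' (x : ℤ × (Fin 3 → ℤ)) (y : Fin 3 → ℤ), ind (x ∈ nodeSet simple) *
        ((∏ i, β i (x.2 i) (y i)) * ∑' τ : ℤ, bracket τ ^ ε *
          (bracket (nodePhase sg x + ∑ i, y i) ^ (-s) *
          kernelWeight (nodePhase sg x + ∑ i, y i) τ)) ≤ C * ∏ i, B i)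
    {sg : ℤ} (hsg : sg ≠ 0) (u : TerminalNode V) (z : ℤ) :
    ∑' j, ind (j u.1 = z) * ∑' τ, bracket τ ^ ε *
      (ind (T.rootIndex r j ∈ nodeSet (r ∈ T.simple)) *
      ∑' y : Fin 3 → ℤ, (∏ i, (M i).b (fun v => j v.1) (y i)) *
        (4 * (bracket (nodePhase sg (T.rootIndex r j) + ∑ i, y i) ^ (-s) *
          kernelWeight (nodePhase sg (T.rootIndex r j) + ∑ i, y i) τ))) ≤
      A ^ Fintype.card (NonterminalNode V) := by
  obtain ⟨⟨i₀, u'⟩, rfl⟩ := (T.terminalEquiv r hr).surjective u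
  set K : ℤ → (Fin 3 → ℤ) → (Fin 3 → ℤ) → ENNReal := fun n q y =>
    ind ((n, q) ∈ nodeSet (r ∈ T.simple)) * (4 * ∑' τ, bracket τ ^ ε *
      (bracket (nodePhase sg (n, q) + ∑ i, y i) ^ (-s) *
        kernelWeight (nodePhase sg (n, q) + ∑ i, y i) τ)) with hK
  -- The constraint at the fixed leaf is absorbed into the factor of the branch `i₀` containing it.
  set f : ∀ i, (Set.Iic (T.child r i) → ℤ) → ℤ → ENNReal :=
    Function.update (fun i => (M i).b) i₀ (fun a σ => ind (a u'.1 = z) * (M i₀).b a σ) with hf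
  have hf0 : f i₀ = fun a σ => ind (a u'.1 = z) * (M i₀).b a σ := Function.update_self ..
  have hf1 : ∀ i, i ≠ i₀ → f i = (M i).b := fun i hi => Function.update_of_ne hi _ _
  have hprod : ∀ (J : ∀ i, Set.Iic (T.child r i) → ℤ) (y : Fin 3 → ℤ),
      ∏ i, f i (J i) (y i) = ind (J i₀ u'.1 = z) * ∏ i, (M i).b (J i) (y i) := by
    intro J y
    rw [Fin.prod_univ_succAbove _ i₀, Fin.prod_univ_succAbove _ i₀, hf0, mul_assoc]
    congr 2
    exact Finset.prod_congr rfl fun k _ => by rw [hf1 _ (Fin.succAbove_ne i₀ k)]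
  have hstep : ∀ j : V → ℤ, ind (j u'.1.1 = z) * ∑' τ, bracket τ ^ ε *
      (ind (T.rootIndex r j ∈ nodeSet (r ∈ T.simple)) *
      ∑' y : Fin 3 → ℤ, (∏ i, (M i).b (fun v => j v.1) (y i)) *
        (4 * (bracket (nodePhase sg (T.rootIndex r j) + ∑ i, y i) ^ (-s) *
          kernelWeight (nodePhase sg (T.rootIndex r j) + ∑ i, y i) τ))) =
      ∑' y : Fin 3 → ℤ, (∏ i, f i (fun v => j v.1) (y i)) *
        K (j T.root) (fun i => j (T.child r i)) y := by
    intro j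
    have e : T.rootIndex r j = (j T.root, fun i => j (T.child r i)) := by
      rw [rootIndex, hr]
    rw [e]
    simp_rw [← ENNReal.tsum_mul_left]
    rw [ENNReal.tsum_comm]
    refine tsum_congr fun y => ?_
    rw [hprod, hK]
    simp_rw [← ENNReal.tsum_mul_left]
    exact tsum_congr fun τ => by ring
  calc _ = ∑' j : V → ℤ, ∑' y : Fin 3 → ℤ, (∏ i, f i (fun v => j v.1) (y i)) *
        K (j T.root) (fun i => j (T.child r i)) y := tsum_congr hstep
    _ ≤ ∑' x : ℤ × ∀ i, Set.Iic (T.child r i) → ℤ, ∑' y : Fin 3 → ℤ,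
        (∏ i, f i (x.2 i) (y i)) * K x.1 (fun i => x.2 i ⟨_, le_rfl⟩) y :=
        ENNReal.tsum_comp_le_tsum_of_injective (T.injective_root_branches r hr)
          (fun x : ℤ × ∀ i, Set.Iic (T.child r i) → ℤ => ∑' y : Fin 3 → ℤ,
        (∏ i, f i (x.2 i) (y i)) * K x.1 (fun i => x.2 i ⟨_, le_rfl⟩) y)
    _ = ∑' n : ℤ, ∑' (q : Fin 3 → ℤ) (y : Fin 3 → ℤ),
        (∏ i, ∑' a : Set.Iic (T.child r i) → ℤ, ind (a ⟨_, le_rfl⟩ = q i) * f i a (y i)) *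
          K n q y := by
        rw [ENNReal.tsum_prod']
        exact tsum_congr fun n => tsum_pi_fin_three_fiberwise
          (fun i (a : Set.Iic (T.child r i) → ℤ) => a ⟨_, le_rfl⟩) f (K n)
    _ = 4 * ∑' (x : ℤ × (Fin 3 → ℤ)) (y : Fin 3 → ℤ), ind (x ∈ nodeSet (r ∈ T.simple)) *
        ((∏ i, ∑' a : Set.Iic (T.child r i) → ℤ, ind (a ⟨_, le_rfl⟩ = x.2 i) * f i a (y i)) *
          ∑' τ : ℤ, bracket τ ^ ε * (bracket (nodePhase sg x + ∑ i, y i) ^ (-s) *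
          kernelWeight (nodePhase sg x + ∑ i, y i) τ)) := by
        rw [← ENNReal.tsum_mul_left, ENNReal.tsum_prod']
        refine tsum_congr fun n => tsum_congr fun q => ?_
        rw [← ENNReal.tsum_mul_left]
        refine tsum_congr fun y => ?_
        rw [hK]
        ring
    _ ≤ 4 * (C * ∏ i, A ^ Fintype.card (NonterminalNode (Set.Iic (T.child r i)))) := by
        gcongr
        refine hC (r ∈ T.simple) sg hsg i₀ (fun i m σ => ∑' a : Set.Iic (T.child r i) → ℤ,
          ind (a ⟨_, le_rfl⟩ = m) * f i a σ) _ (fun i hi m σ => ?_) ?_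
        · simp only [hf1 i hi]
          exact (M i).tsum_root_le m σ
        · refine le_trans (le_of_eq ?_) ((M i₀).tsum_leaf_le u' z)
          simp only [hf0]
          simp_rw [← ENNReal.tsum_mul_right]
          conv_lhs => enter [1, m]; rw [ENNReal.tsum_comm]
          rw [ENNReal.tsum_comm]
          refine tsum_congr fun a => ?_
          rw [← tsum_ind_eq_mul (a ⟨_, le_rfl⟩)
            (fun _ => ind (a u'.1 = z) * ∑' τ, bracket τ ^ ε * (M i₀).b a τ)]
          refine tsum_congr fun m => ?_
          simp_rw [← ENNReal.tsum_mul_left]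
          exact tsum_congr fun σ => by ring
    _ ≤ _ := by
        rw [T.card_nonterminal r hr, pow_add, pow_one, Finset.prod_pow_eq_pow_sum, ← mul_assoc]
        gcongr

end Node

theorem exists_treeMajorant.{u} {κ ε s : ℝ} (hε : 0 < ε) (hε1 : ε < 1) (hκ : 1 + ε < κ)
    (hs : s = κ + ε) (hs2 : s ≤ 2) :
    ∃ A : ENNReal, A ≠ ⊤ ∧ ∀ (o : ℤ), o ≠ 0 → ∀ (V : Type u) [PartialOrder V] [Finite V]
      (T : OrnamentedTree V), Nonempty (TreeMajorant T A κ ε s o) := by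
  obtain ⟨C₁, hC₁, h₁⟩ := tsum_kernelWeight_mul_le le_rfl zero_lt_one
  obtain ⟨C₂, hC₂, h₂⟩ := tsum_node_root_le hε hκ hs hs2
  obtain ⟨C₃, hC₃, h₃⟩ := tsum_node_leaf_le hε hε1 hκ hs
  have hs1 : 1 ≤ s := by linarith
  -- One constant per inductive bound: for `w`, for the root sums and for the leaf sums. The `4` is
  -- that of `enorm_fourierKernel_le`.
  set A := 4 * C₁ + 4 * C₂ + 4 * C₃ with hA
  refine ⟨A, by simp [hA, ENNReal.mul_eq_top, hC₁, hC₂, hC₃], fun o ho V _ _ T => ?_⟩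
  refine induction_on (motive := fun V _ _ T => Nonempty (TreeMajorant T A κ ε s o)) ?_ ?_ V T
  · intro V _ _ _ T
    exact ⟨TreeMajorant.ofSubsingleton T A hs1 o⟩
  · intro V _ _ T r hr ih
    have M : ∀ i, TreeMajorant (T.branch r i) A κ ε s o := fun i => (ih i).some
    set sg : ℤ := (T.sign r.1 : ℤ) * o with hsg
    have hsg0 : sg ≠ 0 := mul_ne_zero (Units.ne_zero _) ho
    refine ⟨⟨fun j => nodeCoeff (nodePhase sg (T.rootIndex r j))
        fun i => (M i).c fun v => j v.1,
      fun j τ => ∑' y : Fin 3 → ℤ, (∏ i, (M i).w (fun v => j v.1) (y i)) *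
        (4 * kernelWeight (nodePhase sg (T.rootIndex r j) + ∑ i, y i) τ),
      fun j τ => ind (T.rootIndex r j ∈ nodeSet (r ∈ T.simple)) *
        ∑' y : Fin 3 → ℤ, (∏ i, (M i).b (fun v => j v.1) (y i)) *
        (4 * (bracket (nodePhase sg (T.rootIndex r j) + ∑ i, y i) ^ (-s) *
          kernelWeight (nodePhase sg (T.rootIndex r j) + ∑ i, y i) τ)), ?_, ?_, ?_, ?_, ?_, ?_⟩⟩
    · exact fun j => summable_nodeCoeff _ fun i => (M i).summable _
    · intro j t ht
      rw [T.treeCoeff_eq_integral r hr _ ht.1,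
        ← integral_node_eq_tsum _ (fun i => (M i).summable _) ht]
      refine intervalIntegral.integral_congr fun x hx => ?_
      rw [Set.uIcc_of_le ht.1] at hx
      rw [nodeExp_eq]
      congr 1
      exact Finset.prod_congr rfl fun i _ => (M i).treeCoeff_eq _ x ⟨hx.1, hx.2.trans ht.2⟩
    · intro j hj τ
      rw [ind_of (rootIndex_mem_nodeSet r hj), one_mul]
      exact enorm_nodeCoeff_le_rpow _ hs1
        (fun i τ => (M i).enorm_le _ (comp_val_mem_indexSet _ hj) τ) τ
    · intro j
      rw [ENNReal.tsum_comm]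
      have h4 : ∀ y : Fin 3 → ℤ, ∑' τ, (∏ i, (M i).w (fun v => j v.1) (y i)) *
          (4 * kernelWeight (nodePhase sg (T.rootIndex r j) + ∑ i, y i) τ) ≤
          (∏ i, (M i).w (fun v => j v.1) (y i)) * A := by
        intro y
        rw [ENNReal.tsum_mul_left, ENNReal.tsum_mul_left]
        gcongr
        refine le_trans (b := 4 * C₁) ?_ (by rw [hA, add_assoc]; exact le_self_add)
        gcongr
        simpa using h₁ (nodePhase sg (T.rootIndex r j) + ∑ i, y i)
      refine (ENNReal.tsum_le_tsum h4).trans ?_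
      rw [ENNReal.tsum_mul_right, tsum_pi_prod (fun i a => (M i).w (fun v => j v.1) a),
        T.card_nonterminal r hr, pow_add, pow_one, ← Finset.prod_pow_eq_pow_sum, mul_comm]
      gcongr with i
      exact (M i).tsum_w_le _
    · exact fun n τ => T.tsum_branches_root_le r hr M
        (by rw [hA, add_right_comm]; exact le_add_self) h₂ hsg0 n τ
    · exact fun u z => T.tsum_branches_leaf_le r hr M (by rw [hA]; exact le_add_self) h₃ hsg0 u z

end OrnamentedTree

/-! ### Multilinear interpolation and norms of sequences. -/

theorem ind_mul_rpow {p : Prop} (a : ENNReal) {r : ℝ} (hp : p) : (ind p * a) ^ r = a ^ r := by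
  rw [ind_of hp, one_mul]

theorem tsum_ind_and_eq_mul {ι α : Type*} (S : Set ι) (g : ι → α) (F : ι → ENNReal)
    (G : α → ENNReal) :
    ∑' (a : α), G a * ∑' j, ind (j ∈ S ∧ g j = a) * F j = ∑' j, ind (j ∈ S) * (F j * G (g j)) := by
  simp_rw [← ENNReal.tsum_mul_left]
  rw [ENNReal.tsum_comm]
  refine tsum_congr fun j => ?_
  rw [← tsum_ind_eq_mul (g j) (fun a => ind (j ∈ S) * (F j * G a))]
  refine tsum_congr fun a => ?_
  rw [ind_and]
  ring

/-- The `ℓ¹` endpoint: as the leaf values determine `j`, the sum is part of the expanded product. -/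
theorem tsum_ind_mul_prod_le {ι W : Type*} [Fintype W] {S : Set ι} {lf : W → ι → ℤ}
    (hinj : Set.InjOn (fun j w => lf w j) S) (Y : W → ℤ → ENNReal) :
    ∑' j, ind (j ∈ S) * ∏ w, Y w (lf w j) ≤ ∏ w, ∑' z, Y w z := by
  rw [← tsum_pi_prod]
  exact tsum_ind_mul_le_of_injOn hinj fun j _ => le_rfl

/-- The splitting for Hölder's inequality: `a` occurs with total exponent `R (α₀ + |W| α) = 1`, and
each `x w` with `P (γ + α) = 1`. -/
theorem mul_prod_eq_rpow {W : Type*} [Fintype W] {R P α₀ α γ : ℝ} (hR : 0 < R) (hP : 0 < P)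
    (hα₀ : 0 ≤ α₀) (hα : 0 ≤ α) (hγ : 0 ≤ γ) (hsum : α₀ + Fintype.card W * α = 1 / R)
    (hαγ : α + γ = 1 / P) (a : ENNReal) (x : W → ENNReal) :
    a * ∏ w, x w = (a ^ R) ^ α₀ * ((∏ w, x w ^ P) ^ γ * ∏ w, (a ^ R * x w ^ P) ^ α) := by
  have hx : ∀ w, x w = (x w ^ P) ^ γ * (x w ^ P) ^ α := by
    intro w
    rw [← ENNReal.rpow_add_of_nonneg _ _ hγ hα, ← ENNReal.rpow_mul, add_comm γ, hαγ,
      mul_one_div_cancel hP.ne', ENNReal.rpow_one]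
  have ha : a = (a ^ R) ^ α₀ * ((a ^ R) ^ α) ^ Fintype.card W := by
    rw [← ENNReal.rpow_natCast, ← ENNReal.rpow_mul (a ^ R),
      ← ENNReal.rpow_add_of_nonneg _ _ hα₀ (by positivity), mul_comm α, hsum, ← ENNReal.rpow_mul,
      mul_one_div_cancel hR.ne', ENNReal.rpow_one]
  simp_rw [ENNReal.mul_rpow_of_nonneg _ _ hα]
  rw [Finset.prod_mul_distrib, Finset.prod_const, Finset.card_univ,
    ← ENNReal.prod_rpow_of_nonneg hγ, mul_left_comm (∏ w, (x w ^ P) ^ γ), ← mul_assoc, ← ha,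
    ← Finset.prod_mul_distrib]
  simp_rw [← hx]

/-- Multilinear interpolation: `ℓ^R` bounds for the kernel `I` with one fixed index give bounds
for the multilinear operator with kernel `I`. -/
theorem tsum_rpow_multilinear_le {ι W : Type*} [Fintype W] {S : Set ι} {rt : ι → ℤ}
    {lf : W → ι → ℤ} (hinj : Set.InjOn (fun j w => lf w j) S) {I : ι → ENNReal} {R : ℝ}
    {Λ : ENNReal} (hrt : ∀ n, ∑' j, ind (j ∈ S ∧ rt j = n) * I j ^ R ≤ Λ)
    (hlf : ∀ w z, ∑' j, ind (j ∈ S ∧ lf w j = z) * I j ^ R ≤ Λ)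
    {P Q α γ : ℝ} (hR : 0 < R) (hP : 0 < P) (hQ : 1 ≤ Q) (hα : 0 ≤ α) (hγ : 0 ≤ γ)
    (hαγ : α + γ = 1 / P) (hQγ : Fintype.card W * α + γ = 1 / Q) (hRγ : 1 / R = 1 - γ)
    (X : W → ℤ → ENNReal) :
    ∑' n, (∑' j, ind (j ∈ S ∧ rt j = n) * (I j * ∏ w, X w (lf w j))) ^ Q ≤
      (Λ ^ (1 / R) * ∏ w, (∑' z, X w z ^ P) ^ (1 / P)) ^ Q := by
  classical
  have hQ0 : 0 < Q := by linarith
  -- The exponent left for the kernel alone, so that `α₀ + γ + |W| α = 1`.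
  set α₀ := 1 - 1 / Q with hα₀
  have hα₀0 : 0 ≤ α₀ := by
    rw [hα₀, sub_nonneg, div_le_one hQ0]; exact hQ
  have hsum : α₀ + Fintype.card W * α = 1 / R := by rw [hRγ]; linarith
  set A : W → ℤ → ENNReal := fun w n =>
    ∑' j, ind (j ∈ S ∧ rt j = n) * (I j ^ R * X w (lf w j) ^ P) with hA
  set Γ : ℤ → ENNReal := fun n => ∑' j, ind (j ∈ S ∧ rt j = n) * ∏ w, X w (lf w j) ^ P with hΓ
  have hpt : ∀ n, ∑' j, ind (j ∈ S ∧ rt j = n) * (I j * ∏ w, X w (lf w j)) ≤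
      Λ ^ α₀ * (Γ n ^ γ * ∏ w, A w n ^ α) := by
    intro n
    let F : Option (Option W) → ι → ENNReal := fun k j => ind (j ∈ S ∧ rt j = n) *
      match k with
      | none => I j ^ R
      | some none => ∏ w, X w (lf w j) ^ P
      | some (some w) => I j ^ R * X w (lf w j) ^ P
    let e : Option (Option W) → ℝ := fun k =>
      match k with
      | none => α₀
      | some none => γ
      | some (some _) => α
    have h := tsum_prod_rpow_le Finset.univ F e
      (by
        simp only [Fintype.sum_option, e, Finset.sum_const, Finset.card_univ, nsmul_eq_mul]
        linarith)
      (by rintro (_ | _ | w) - <;> assumption)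
    simp only [Fintype.prod_option] at h
    refine le_trans (ENNReal.tsum_le_tsum fun j => ?_) (h.trans ?_)
    · by_cases hj : j ∈ S ∧ rt j = n
      · simp only [F, e, ind_mul_rpow _ hj]
        rw [ind_of hj, one_mul]
        exact (mul_prod_eq_rpow hR hP hα₀0 hα hγ hsum hαγ _ _).le
      · rw [ind_of_not hj, zero_mul]; exact zero_le
    · refine mul_le_mul' (ENNReal.rpow_le_rpow (hrt n) hα₀0) le_rfl
  have hΓsum : ∑' n, Γ n ≤ ∏ w, ∑' z, X w z ^ P := by
    have := tsum_ind_and_eq_mul S rt (fun j => ∏ w, X w (lf w j) ^ P) (fun _ => 1)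
    simp only [one_mul, mul_one] at this
    rw [hΓ, this]
    exact tsum_ind_mul_prod_le hinj fun w z => X w z ^ P
  -- Summing over `n` frees the root; regrouping by the value at the leaf `w` then calls on the leaf
  -- bound of the kernel.
  have hAsum : ∀ w, ∑' n, A w n ≤ Λ * ∑' z, X w z ^ P := by
    intro w
    have h1 := tsum_ind_and_eq_mul S rt (fun j => I j ^ R * X w (lf w j) ^ P) (fun _ => 1)
    have h2 := tsum_ind_and_eq_mul S (lf w) (fun j => I j ^ R) (fun z => X w z ^ P)
    simp only [one_mul, mul_one] at h1
    rw [hA, h1, ← h2, ← ENNReal.tsum_mul_left]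
    refine ENNReal.tsum_le_tsum fun z => ?_
    rw [mul_comm Λ]
    gcongr
    exact hlf w z
  calc _ ≤ ∑' n, (Λ ^ α₀ * (Γ n ^ γ * ∏ w, A w n ^ α)) ^ Q :=
        ENNReal.tsum_le_tsum fun n => ENNReal.rpow_le_rpow (hpt n) hQ0.le
    _ = Λ ^ (α₀ * Q) * ∑' n, Γ n ^ (γ * Q) * ∏ w, A w n ^ (α * Q) := by
        rw [← ENNReal.tsum_mul_left]
        refine tsum_congr fun n => ?_
        rw [ENNReal.mul_rpow_of_nonneg _ _ hQ0.le, ENNReal.mul_rpow_of_nonneg _ _ hQ0.le,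
          ← ENNReal.prod_rpow_of_nonneg hQ0.le]
        simp only [ENNReal.rpow_mul]
    -- A second Hölder inequality, now in `n`: the exponents `γ Q` and `α Q`, the latter once per
    -- leaf, add up to `1`.
    _ ≤ Λ ^ (α₀ * Q) * ((∑' n, Γ n) ^ (γ * Q) * ∏ w, (∑' n, A w n) ^ (α * Q)) := by
        gcongr
        let F : Option W → ℤ → ENNReal := fun k => k.elim Γ A
        let e : Option W → ℝ := fun k => k.elim (γ * Q) fun _ => α * Q
        have h := tsum_prod_rpow_le Finset.univ F e
          (by
            simp only [Fintype.sum_option, e, Option.elim, Finset.sum_const, Finset.card_univ,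
              nsmul_eq_mul]
            rw [← mul_assoc, ← add_mul, add_comm, hQγ, one_div_mul_cancel hQ0.ne'])
          (by rintro (_ | w) - <;> exact mul_nonneg (by assumption) hQ0.le)
        simpa only [Fintype.prod_option, F, e, Option.elim] using h
    _ ≤ Λ ^ (α₀ * Q) * ((∏ w, ∑' z, X w z ^ P) ^ (γ * Q) *
          ∏ w, (Λ * ∑' z, X w z ^ P) ^ (α * Q)) := by
        gcongr with w
        exact hAsum w
    _ = _ := by
        have hγQ : 0 ≤ γ * Q := by positivity
        have hαQ : 0 ≤ α * Q := by positivity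
        rw [ENNReal.mul_rpow_of_nonneg _ _ hQ0.le, ← ENNReal.prod_rpow_of_nonneg hQ0.le,
          ← ENNReal.prod_rpow_of_nonneg hγQ, ← ENNReal.rpow_mul, ← Finset.prod_mul_distrib]
        simp_rw [ENNReal.mul_rpow_of_nonneg _ _ hαQ, ← ENNReal.rpow_mul]
        simp_rw [mul_left_comm]
        rw [Finset.prod_mul_distrib, Finset.prod_const, Finset.card_univ, ← mul_assoc,
          ← ENNReal.rpow_natCast, ← ENNReal.rpow_mul,
          ← ENNReal.rpow_add_of_nonneg _ _ (by positivity) (by positivity)]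
        congr 1
        · congr 1; rw [← hsum]; ring
        · refine Finset.prod_congr rfl fun w _ => ?_
          rw [← ENNReal.rpow_add_of_nonneg _ _ hγQ hαQ, ← add_mul, add_comm, hαγ]

theorem tsum_rpow_le_rpow_tsum {a : ℤ → ENNReal} {Q q : ℝ} (hQ : 0 < Q) (hq : Q ≤ q) :
    ∑' n, a n ^ q ≤ (∑' n, a n ^ Q) ^ (q / Q) := by
  have h1 : ∀ n, a n ^ q ≤ a n ^ Q * (∑' n, a n ^ Q) ^ ((q - Q) / Q) := by
    intro n
    have h2 : a n ≤ (∑' n, a n ^ Q) ^ (1 / Q) := by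
      rw [one_div, ENNReal.le_rpow_inv_iff hQ]
      exact ENNReal.le_tsum (f := fun n => a n ^ Q) n
    calc a n ^ q = a n ^ Q * a n ^ (q - Q) := by
          rw [← ENNReal.rpow_add_of_nonneg _ _ hQ.le (by linarith)]; congr 1; ring
      _ ≤ a n ^ Q * ((∑' n, a n ^ Q) ^ (1 / Q)) ^ (q - Q) := by
          gcongr
      _ = _ := by rw [← ENNReal.rpow_mul]; congr 2; ring
  refine (ENNReal.tsum_le_tsum h1).trans ?_
  rw [ENNReal.tsum_mul_right]
  apply le_of_eq
  nth_rewrite 1 [← ENNReal.rpow_one (∑' n, a n ^ Q)]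
  rw [← ENNReal.rpow_add_of_nonneg _ _ zero_le_one (div_nonneg (by linarith) hQ.le)]
  congr 1
  field_simp
  ring

theorem ellNorm_eq {p : ENNReal} (h0 : p ≠ 0) (h1 : p ≠ ⊤) (x : ℤ → ℂ) :
    ellNorm p x = (∑' n, ‖x n‖ₑ ^ p.toReal) ^ (1 / p.toReal) := by
  rw [ellNorm, eLpNorm_eq_lintegral_rpow_enorm_toReal h0 h1, lintegral_count]

theorem ellNorm_anti {q q' : ENNReal} (h0 : q ≠ 0) (h1 : q ≠ ⊤) (h : q ≤ q') (x : ℤ → ℂ) :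
    ellNorm q' x ≤ ellNorm q x := by
  have hq : 0 < q.toReal := ENNReal.toReal_pos h0 h1
  rw [ellNorm_eq h0 h1]
  by_cases h2 : q' = ⊤
  · subst h2
    rw [ellNorm, eLpNorm_exponent_top]
    refine essSup_le_of_ae_le _ (Filter.Eventually.of_forall fun n => ?_)
    rw [one_div, ENNReal.le_rpow_inv_iff hq]
    exact ENNReal.le_tsum (f := fun n => ‖x n‖ₑ ^ q.toReal) n
  · have h0' : q' ≠ 0 := (lt_of_lt_of_le (pos_iff_ne_zero.mpr h0) h).ne'
    have hq' : 0 < q'.toReal := ENNReal.toReal_pos h0' h2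
    rw [ellNorm_eq h0' h2]
    calc _ ≤ ((∑' n, ‖x n‖ₑ ^ q.toReal) ^ (q'.toReal / q.toReal)) ^ (1 / q'.toReal) := by
          gcongr
          exact tsum_rpow_le_rpow_tsum hq (ENNReal.toReal_mono h2 h)
      _ = _ := by
          rw [← ENNReal.rpow_mul]
          congr 1
          field_simp

/-! ### Bounds for the tree coefficients and the tree operator. -/

namespace OrnamentedTree

theorem enorm_treeCoeff_le {V : Type*} [PartialOrder V] [Finite V] (T : OrnamentedTree V) (ω : ℝ)
    {t : ℝ} (ht : 0 ≤ t) (j : V → ℤ) :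
    ‖T.treeCoeff ω t j‖ₑ ≤ ENNReal.ofReal t ^ Fintype.card (NonterminalNode V) := by
  rw [← ofReal_norm, ← ENNReal.ofReal_pow ht]
  exact ENNReal.ofReal_le_ofReal (T.norm_treeCoeff_le ω ht j)

/-- Hölder's inequality in `τ` uses up the uniform bound on `w` and leaves `b` to the first power,
ready for summation over `j`. -/
theorem TreeMajorant.enorm_treeCoeff_rpow_le {V : Type*} [PartialOrder V] [Finite V]
    {T : OrnamentedTree V} {A : ENNReal} {κ ε s : ℝ} {o : ℤ} (M : TreeMajorant T A κ ε s o)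
    (hs : 1 ≤ s) {t : ℝ} (ht : t ∈ Set.Icc (0 : ℝ) 1) {j : V → ℤ} (hj : j ∈ T.indexSet) :
    ‖T.treeCoeff o t j‖ₑ ^ s ≤
      (A ^ Fintype.card (NonterminalNode V)) ^ (s - 1) * ∑' τ, M.b j τ := by
  have hs0 : 0 < s := by linarith
  have h0 : 0 ≤ 1 / s := by positivity
  have h0' : 0 ≤ 1 - 1 / s := by
    rw [sub_nonneg, div_le_one hs0]; exact hs
  have h1 : ‖T.treeCoeff o t j‖ₑ ≤
      (A ^ Fintype.card (NonterminalNode V)) ^ (1 - 1 / s) * (∑' τ, M.b j τ) ^ (1 / s) := by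
    rw [M.treeCoeff_eq j t ht]
    calc _ ≤ ∑' τ, ‖M.c j τ‖ₑ := by
          refine enorm_tsum_le_tsum_enorm.trans_eq (tsum_congr fun τ => ?_)
          rw [enorm_mul, ← ofReal_norm (Complex.exp _),
            show Complex.I * (τ : ℂ) * (t : ℂ) = ((τ * t : ℝ) : ℂ) * Complex.I by
              push_cast; ring, Complex.norm_exp_ofReal_mul_I, ENNReal.ofReal_one, mul_one]
      _ ≤ ∑' τ, M.w j τ ^ (1 - 1 / s) * M.b j τ ^ (1 / s) :=
          ENNReal.tsum_le_tsum fun τ => M.enorm_le j hj τ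
      _ ≤ (∑' τ, M.w j τ) ^ (1 - 1 / s) * (∑' τ, M.b j τ) ^ (1 / s) :=
          tsum_rpow_mul_rpow_le _ _ h0' h0 (by ring)
      _ ≤ _ := by gcongr; exact M.tsum_w_le j
  refine (ENNReal.rpow_le_rpow h1 hs0.le).trans_eq ?_
  rw [ENNReal.mul_rpow_of_nonneg _ _ hs0.le, ← ENNReal.rpow_mul, ← ENNReal.rpow_mul,
    one_div_mul_cancel hs0.ne', ENNReal.rpow_one, sub_mul, one_div_mul_cancel hs0.ne', one_mul]

/-- `ℓ^R` bounds for the tree coefficients with one fixed index. -/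
theorem tsum_treeCoeff_rpow_le.{u} {R : ℝ} (hR : 1 < R) :
    ∃ (C : ENNReal) (η : ℝ), C ≠ ⊤ ∧ 0 < η ∧ ∀ (o : ℤ), o ≠ 0 →
      ∀ (V : Type u) [PartialOrder V] [Finite V] (T : OrnamentedTree V),
      1 ≤ Fintype.card (NonterminalNode V) → ∀ t ∈ Set.Icc (0 : ℝ) 1,
      (∀ n, ∑' j, ind (j ∈ T.indexSet ∧ j T.root = n) * ‖T.treeCoeff o t j‖ₑ ^ R ≤
        (C * ENNReal.ofReal t ^ η) ^ Fintype.card (NonterminalNode V)) ∧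
      (∀ (u : TerminalNode V) z,
        ∑' j, ind (j ∈ T.indexSet ∧ j u.1 = z) * ‖T.treeCoeff o t j‖ₑ ^ R ≤
        (C * ENNReal.ofReal t ^ η) ^ Fintype.card (NonterminalNode V)) := by
  -- Strictly between `1` and `R`, so that `R - s` remains for the power of `t`, and at most `2` as
  -- the triangle coefficients require.
  set s : ℝ := min 2 ((1 + R) / 2) with hs
  have hs1 : 1 < s := lt_min (by norm_num) (by linarith)
  have hs2 : s ≤ 2 := min_le_left _ _
  have hsR : s < R := (min_le_right _ _).trans_lt (by linarith)
  -- Then `κ = s - ε = 1 + 2 ε`, which exceeds `1 + ε`.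
  set ε := (s - 1) / 3 with hε
  have hε0 : 0 < ε := by rw [hε]; linarith
  have hε1 : ε < 1 := by rw [hε]; linarith
  set κ := s - ε with hκ
  have hκ1 : 1 + ε < κ := by rw [hκ, hε]; linarith
  obtain ⟨A, hA, h⟩ := exists_treeMajorant hε0 hε1 hκ1 (show s = κ + ε by rw [hκ]; ring) hs2
  set S := ∑' τ : ℤ, bracket τ ^ (-κ) with hS
  have hS1 : 1 ≤ S := by
    have := ENNReal.le_tsum (f := fun τ : ℤ => bracket τ ^ (-κ)) 0
    simpa using this
  have hStop : S ≠ ⊤ := tsum_bracket_rpow_ne_top (by linarith)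
  refine ⟨A ^ s * S, R - s, ENNReal.mul_ne_top (ENNReal.rpow_ne_top_of_nonneg (by linarith) hA)
    hStop, by linarith, fun o ho V _ _ T hm t ht => ?_⟩
  obtain ⟨M⟩ := h o ho V T
  set m := Fintype.card (NonterminalNode V) with hmdef
  have hpt : ∀ j ∈ T.indexSet, ‖T.treeCoeff o t j‖ₑ ^ R ≤
      (ENNReal.ofReal t ^ (R - s)) ^ m * (A ^ m) ^ (s - 1) * ∑' τ, M.b j τ := by
    intro j hj
    calc ‖T.treeCoeff o t j‖ₑ ^ R =
          ‖T.treeCoeff o t j‖ₑ ^ (R - s) * ‖T.treeCoeff o t j‖ₑ ^ s := by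
          rw [← ENNReal.rpow_add_of_nonneg _ _ (by linarith) (by linarith), sub_add_cancel]
      _ ≤ (ENNReal.ofReal t ^ m) ^ (R - s) * ((A ^ m) ^ (s - 1) * ∑' τ, M.b j τ) := by
          refine mul_le_mul' (ENNReal.rpow_le_rpow (T.enorm_treeCoeff_le _ ht.1 j) (by linarith))
            (M.enorm_treeCoeff_rpow_le hs1.le ht hj)
      _ = _ := by
          rw [← mul_assoc]
          congr 2
          rw [← ENNReal.rpow_natCast, ← ENNReal.rpow_mul, mul_comm, ENNReal.rpow_mul,
            ENNReal.rpow_natCast]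
  have hfin : ∀ x : ENNReal, x ≤ A ^ m * S →
      (ENNReal.ofReal t ^ (R - s)) ^ m * (A ^ m) ^ (s - 1) * x ≤
      (A ^ s * S * ENNReal.ofReal t ^ (R - s)) ^ m := by
    intro x hx
    calc _ ≤ (ENNReal.ofReal t ^ (R - s)) ^ m * (A ^ m) ^ (s - 1) * (A ^ m * S ^ m) := by
          gcongr
          -- With `m ≥ 1`, the single factor `S` is enlarged to `S ^ m`, which makes the bound an
          -- `m`-th power.
          exact hx.trans (by gcongr; exact le_self_pow hS1 (by omega))
      _ = (ENNReal.ofReal t ^ (R - s)) ^ m * S ^ m * ((A ^ m) ^ (s - 1) * A ^ m) := by ring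
      _ = (ENNReal.ofReal t ^ (R - s)) ^ m * S ^ m * (A ^ s) ^ m := by
          congr 1
          nth_rewrite 2 [← ENNReal.rpow_one (A ^ m)]
          rw [← ENNReal.rpow_add_of_nonneg _ _ (by linarith) zero_le_one, sub_add_cancel,
            ← ENNReal.rpow_natCast, ← ENNReal.rpow_mul, mul_comm, ENNReal.rpow_mul,
            ENNReal.rpow_natCast]
      _ = _ := by rw [mul_pow, mul_pow]; ring
  have hgen : ∀ p : (V → ℤ) → Prop, ∑' j, ind (p j) * ∑' τ, M.b j τ ≤ A ^ m * S →
      ∑' j, ind (j ∈ T.indexSet ∧ p j) * ‖T.treeCoeff o t j‖ₑ ^ R ≤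
        (A ^ s * S * ENNReal.ofReal t ^ (R - s)) ^ m := by
    intro p hp
    refine le_trans ?_ (hfin _ hp)
    rw [← ENNReal.tsum_mul_left]
    refine ENNReal.tsum_le_tsum fun j => ?_
    by_cases hj : j ∈ T.indexSet ∧ p j
    · rw [ind_of hj, ind_of hj.2, one_mul, one_mul]
      exact hpt j hj.1
    · rw [ind_of_not hj, zero_mul]; exact zero_le
  constructor
  · intro n
    refine hgen (fun j => j T.root = n) ?_
    simp_rw [← ENNReal.tsum_mul_left]
    rw [ENNReal.tsum_comm, hS, ← ENNReal.tsum_mul_left]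
    exact ENNReal.tsum_le_tsum fun τ => M.tsum_root_le n τ
  · intro u z
    refine hgen (fun j => j u.1 = z) (le_trans ?_
      ((M.tsum_leaf_le u z).trans (le_mul_of_one_le_right zero_le hS1)))
    gcongr with j τ
    exact le_mul_of_one_le_left zero_le (one_le_bracket_rpow τ hε0.le)

section Bound

variable {V : Type*} [PartialOrder V] [Finite V] (T : OrnamentedTree V) (ω : ℝ) {t : ℝ}
  (x : TerminalNode V → ℤ → ℂ)

theorem enorm_treeTerm (j : V → ℤ) : ‖T.treeTerm ω t x j‖ₑ =
    ‖T.treeCoeff ω t j‖ₑ * ∏ w, ‖x w (j w.1)‖ₑ := by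
  rw [treeTerm, enorm_mul]
  simp only [enorm_eq_nnnorm, nnnorm_prod, ENNReal.ofNNReal_finsetProd]

theorem enorm_treeCoeff_le_one (ht : t ∈ Set.Icc (0 : ℝ) 1) (j : V → ℤ) :
    ‖T.treeCoeff ω t j‖ₑ ≤ 1 :=
  (T.enorm_treeCoeff_le ω ht.1 j).trans (pow_le_one₀ zero_le (by simpa using ht.2))

/-- The kernel is at most `1` and the leaf values determine `j`, so the product of the `ℓ¹` norms
dominates. -/
theorem summable_treeTerm (ht : t ∈ Set.Icc (0 : ℝ) 1) (hx : ∀ w, ellNorm 1 (x w) < ⊤) (n : ℤ) :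
    Summable (fun j : {j : V → ℤ // j ∈ T.indexSet ∧ j T.root = n} => T.treeTerm ω t x j.1) := by
  refine Summable.of_enorm (ne_top_of_le_ne_top (b := ∏ w, ∑' z, ‖x w z‖ₑ) ?_ ?_)
  · refine ENNReal.prod_ne_top fun w _ => ?_
    have := hx w
    rw [ellNorm_eq one_ne_zero ENNReal.one_ne_top] at this
    simpa using this.ne
  · rw [← tsum_ind_mul_eq_tsum_subtype' (fun j => j ∈ T.indexSet ∧ j T.root = n)
      (fun j => ‖T.treeTerm ω t x j‖ₑ)]
    refine le_trans (ENNReal.tsum_le_tsum fun j => ?_)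
      (tsum_ind_mul_prod_le T.injOn_indexSet fun w z => ‖x w z‖ₑ)
    by_cases hj : j ∈ T.indexSet ∧ j T.root = n
    · rw [ind_of hj.1, ind_of hj, one_mul, one_mul, enorm_treeTerm]
      exact mul_le_of_le_one_left zero_le (T.enorm_treeCoeff_le_one ω ht j)
    · rw [ind_of_not hj, zero_mul]
      exact zero_le

theorem enorm_treeOperator_le (n : ℤ) : ‖T.treeOperator ω t x n‖ₑ ≤
    ∑' j, ind (j ∈ T.indexSet ∧ j T.root = n) *
      (‖T.treeCoeff ω t j‖ₑ * ∏ w, ‖x w (j w.1)‖ₑ) := by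
  rw [treeOperator]
  refine enorm_tsum_le_tsum_enorm.trans_eq ?_
  rw [← tsum_ind_mul_eq_tsum_subtype' (fun j => j ∈ T.indexSet ∧ j T.root = n)
      (fun j => ‖T.treeTerm ω t x j‖ₑ)]
  exact tsum_congr fun j => by rw [enorm_treeTerm]

end Bound

end OrnamentedTree

/-! ### Choice of exponents and conclusion. -/

/-- The exponents of the interpolation for trees with `N` terminal nodes, uniformly in `N`. -/
theorem exists_interpolation_exponents {P Q : ℝ} (hP : 1 < P) (hQ : 1 ≤ Q) (hQP : Q ≤ P) :
    ∃ R₀ : ℝ, 1 < R₀ ∧ ∀ N : ℕ, 2 ≤ N → P / N < Q → ∃ R α γ : ℝ, R₀ ≤ R ∧ 0 ≤ α ∧ 0 ≤ γ ∧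
      α + γ = 1 / P ∧ N * α + γ = 1 / Q ∧ 1 / R = 1 - γ := by
  have hP0 : 0 < P := by linarith
  have hQ0 : 0 < Q := by linarith
  have hd : 0 ≤ 1 / Q - 1 / P := sub_nonneg.mpr (one_div_le_one_div_of_le hQ0 hQP)
  -- The least `N ≥ 2` with `P / N < Q`.
  set N₀ : ℕ := max 2 (⌊P / Q⌋₊ + 1) with hN₀
  have hN₀2 : (2 : ℝ) ≤ N₀ := by exact_mod_cast le_max_left _ _
  have hN₀Q : P / Q < N₀ := (Nat.lt_floor_add_one _).trans_le (by
    exact_mod_cast le_max_right 2 (⌊P / Q⌋₊ + 1))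
  -- The value of `γ` at `N = N₀`. As `γ` does not decrease with `N`, it is a positive lower bound
  -- for `γ`, and `R ≥ 1 / (1 - g) > 1` uniformly.
  set g : ℝ := 1 / P - (1 / Q - 1 / P) / (N₀ - 1) with hg
  have hg0 : 0 < g := by
    have h1 : (1 / Q - 1 / P) / ((N₀ : ℝ) - 1) < 1 / P := by
      rw [div_lt_iff₀ (by linarith), mul_sub, mul_one, sub_lt_sub_iff_right, div_mul_eq_mul_div,
        one_mul, lt_div_iff₀ hP0, div_mul_eq_mul_div, one_mul]
      exact hN₀Q
    linarith
  have hP1 : 1 / P < 1 := by rw [div_lt_one hP0]; exact hP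
  have hgP : g ≤ 1 / P := sub_le_self _ (div_nonneg hd (by linarith))
  refine ⟨1 / (1 - g), ?_, fun N hN hNQ => ?_⟩
  · rw [lt_div_iff₀ (by linarith)]; linarith
  · have hN2 : (2 : ℝ) ≤ N := by exact_mod_cast hN
    have hNN₀ : (N₀ : ℝ) ≤ N := by
      have h1 : P / Q < N := by
        rw [div_lt_iff₀ hQ0]
        rw [div_lt_iff₀ (by linarith)] at hNQ
        linarith
      have : N₀ ≤ N := max_le hN ((Nat.floor_lt (by positivity)).mpr h1)
      exact_mod_cast this
    set α : ℝ := (1 / Q - 1 / P) / (N - 1) with hα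
    have hα0 : 0 ≤ α := div_nonneg hd (by linarith)
    have hαle : α ≤ (1 / Q - 1 / P) / (N₀ - 1) :=
      div_le_div_of_nonneg_left hd (by linarith) (by linarith)
    have hαN : (N - 1) * α = 1 / Q - 1 / P := by
      rw [hα]; field_simp [show (N : ℝ) - 1 ≠ 0 by linarith]
    refine ⟨1 / (1 - (1 / P - α)), α, 1 / P - α, ?_, hα0, by linarith, by ring, ?_, ?_⟩
    · exact one_div_le_one_div_of_le (by linarith) (by linarith)
    · linarith
    · rw [one_div_one_div]

theorem proposition5p3 (ω : ℝ) (hω : ω = 1 ∨ ω = -1) (p q : ENNReal)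
    (hp : 1 < p) (hp' : p < ⊤) (hq : 1 ≤ q) :
    ∃ ε C : ℝ, 0 < ε ∧ 0 < C ∧
      ∀ (V : Type*) [PartialOrder V] [Finite V] [Nontrivial V] (T : OrnamentedTree V),
        p / (Fintype.card (TerminalNode V) : ENNReal) < q →
        ∀ t ∈ Set.Icc (0 : ℝ) 1, ∀ x : TerminalNode V → ℤ → ℂ,
          (∀ w, ellNorm 1 (x w) < ⊤) →
          (∀ n : ℤ, Summable
            (fun j : {j : V → ℤ // j ∈ T.indexSet ∧ j T.root = n} => T.treeTerm ω t x j.1)) ∧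
          ellNorm q (T.treeOperator ω t x) ≤
            ENNReal.ofReal ((C * t ^ ε) ^ Fintype.card (TerminalNode V)) *
              ∏ w : TerminalNode V, ellNorm p (x w) := by
  -- Only the integrality of `ω` and `ω ≠ 0` matter: they make the phases nonzero integer multiples
  -- of the resonances.
  obtain ⟨o, ho, rfl⟩ : ∃ o : ℤ, o ≠ 0 ∧ ω = (o : ℝ) := by
    rcases hω with rfl | rfl
    · exact ⟨1, by norm_num, by norm_num⟩
    · exact ⟨-1, by norm_num, by norm_num⟩
  -- The `ℓ^q` norm decreases in `q`, so the case `q > p` reduces to `q = p`; the condition `p / N <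
  -- q₁` persists because `N > 1`.
  set q₁ := min q p with hq₁
  have hp0 : p ≠ 0 := (zero_lt_one.trans hp).ne'
  have hq₁1 : 1 ≤ q₁ := le_min hq hp.le
  have hq₁0 : q₁ ≠ 0 := (zero_lt_one.trans_le hq₁1).ne'
  have hq₁t : q₁ ≠ ⊤ := ((min_le_right q p).trans_lt hp').ne
  set P := p.toReal with hPdef
  set Q := q₁.toReal with hQdef
  have hP : 1 < P := by
    simpa using (ENNReal.toReal_lt_toReal ENNReal.one_ne_top hp'.ne).mpr hp
  have hQ : 1 ≤ Q := by simpa using ENNReal.toReal_mono hq₁t hq₁1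
  have hQP : Q ≤ P := ENNReal.toReal_mono hp'.ne (min_le_right _ _)
  have hP0 : 0 < P := by linarith
  have hQ0 : 0 < Q := by linarith
  obtain ⟨R₀, hR₀, hexp⟩ := exists_interpolation_exponents hP hQ hQP
  obtain ⟨C, η, hC, hη, hkey⟩ := OrnamentedTree.tsum_treeCoeff_rpow_le hR₀
  have hP1 : 0 < 1 - 1 / P := by
    rw [sub_pos, div_lt_one hP0]; exact hP
  -- Being at least `1`, it allows the exponent `m / R` to be raised to `N`.
  set C₁ := max 1 C with hC₁
  have hC₁t : C₁ ≠ ⊤ := (max_lt ENNReal.one_lt_top hC.lt_top).ne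
  have hC₁1 : 1 ≤ C₁ := le_max_left _ _
  -- From `1 / R = 1 - γ ≥ 1 - 1 / P` and `N = 2 m + 1 ≤ 3 m`.
  refine ⟨η * (1 - 1 / P) / 3, C₁.toReal, by positivity,
    ENNReal.toReal_pos (zero_lt_one.trans_le hC₁1).ne' hC₁t,
    fun V _ _ _ T hN t ht x hx => ⟨fun n => T.summable_treeTerm _ x ht hx n, ?_⟩⟩
  set m := Fintype.card (NonterminalNode V) with hm
  set N := Fintype.card (TerminalNode V) with hNdef
  have hNm : N = 2 * m + 1 := T.card_terminal
  have hm1 : 1 ≤ m := by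
    rw [Nat.one_le_iff_ne_zero]
    intro h0
    have : ∀ w, ¬ w ⋖ T.root := fun w hw =>
      (Fintype.card_eq_zero_iff.mp h0).false (⟨T.root, w, hw⟩ : NonterminalNode V)
    exact not_subsingleton V (T.subsingleton_of_terminal_root this)
  have hNQ : P / N < Q := by
    have h1 : p / (N : ENNReal) < q₁ := by
      refine lt_min hN ?_
      rw [ENNReal.div_lt_iff (Or.inl (by simp; omega)) (Or.inl (by simp))]
      nth_rewrite 1 [← mul_one p]
      exact ENNReal.mul_lt_mul_right hp0 hp'.ne (by exact_mod_cast (by omega : 1 < N))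
    have h2 := (ENNReal.toReal_lt_toReal h1.ne_top hq₁t).mpr h1
    simpa [ENNReal.toReal_div] using h2
  obtain ⟨R, α, γ, hR₀R, hα, hγ, hαγ, hQγ, hRγ⟩ := hexp N (by omega) hNQ
  have hR0 : 0 < R := by linarith
  obtain ⟨hrt, hlf⟩ := hkey o ho V T hm1 t ht
  -- `R` depends on `N`, while the constants must not; since the kernel is at most `1`, the bound
  -- for `R₀` serves every `R ≥ R₀`.
  have hI : ∀ (pr : (V → ℤ) → Prop), ∑' j, ind (pr j) * ‖T.treeCoeff o t j‖ₑ ^ R ≤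
      ∑' j, ind (pr j) * ‖T.treeCoeff o t j‖ₑ ^ R₀ := by
    intro pr
    refine ENNReal.tsum_le_tsum fun j => mul_le_mul' le_rfl ?_
    exact ENNReal.rpow_le_rpow_of_exponent_ge (T.enorm_treeCoeff_le_one _ ht j) hR₀R
  have hmain := tsum_rpow_multilinear_le (S := T.indexSet) (rt := fun j => j T.root)
    (lf := fun w j => j w.1) T.injOn_indexSet (fun n => (hI _).trans (hrt n))
    (fun w z => (hI _).trans (hlf w z)) hR0 hP0 hQ hα hγ hαγ hQγ hRγ fun w z => ‖x w z‖ₑ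
  refine (ellNorm_anti hq₁0 hq₁t (min_le_left q p) _).trans ?_
  rw [ellNorm_eq hq₁0 hq₁t]
  have h1 : ∑' n, ‖T.treeOperator o t x n‖ₑ ^ Q ≤ _ :=
    (ENNReal.tsum_le_tsum fun n =>
      ENNReal.rpow_le_rpow (T.enorm_treeOperator_le o x n) hQ0.le).trans hmain
  have h2 := ENNReal.rpow_le_rpow h1 (one_div_nonneg.mpr hQ0.le)
  rw [← ENNReal.rpow_mul, mul_one_div_cancel hQ0.ne', ENNReal.rpow_one] at h2
  refine h2.trans ?_
  have h3 : ∏ w : TerminalNode V, ellNorm p (x w) =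
      ∏ w : TerminalNode V, (∑' z, ‖x w z‖ₑ ^ P) ^ (1 / P) :=
    Finset.prod_congr rfl fun w _ => ellNorm_eq hp0 hp'.ne (x w)
  rw [h3]
  gcongr
  have hτ1 : ENNReal.ofReal t ≤ 1 := by simpa using ht.2
  have hR1 : 1 / R ≤ 1 := by rw [hRγ]; linarith
  have hRP : 1 - 1 / P ≤ 1 / R := by rw [hRγ]; linarith
  have hNm' : (N : ℝ) = 2 * m + 1 := by rw [hNm]; push_cast; ring
  have hm1' : (1 : ℝ) ≤ m := by exact_mod_cast hm1
  have hRpos : 0 < 1 / R := by positivity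
  calc ((C * ENNReal.ofReal t ^ η) ^ m) ^ (1 / R)
      = C ^ (m * (1 / R)) * ENNReal.ofReal t ^ (η * (m * (1 / R))) := by
        rw [← ENNReal.rpow_natCast, ← ENNReal.rpow_mul,
          ENNReal.mul_rpow_of_nonneg _ _ (by positivity), ← ENNReal.rpow_mul]
    _ ≤ C₁ ^ (N : ℝ) * ENNReal.ofReal t ^ (η * (1 - 1 / P) / 3 * N) := by
        refine mul_le_mul' ?_ (ENNReal.rpow_le_rpow_of_exponent_ge hτ1 ?_)
        · calc C ^ (m * (1 / R)) ≤ C₁ ^ (m * (1 / R)) :=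
                ENNReal.rpow_le_rpow (le_max_right _ _) (by positivity)
            _ ≤ _ := ENNReal.rpow_le_rpow_of_exponent_le hC₁1 (by nlinarith)
        · have h4 : (1 - 1 / P) * (N / 3) ≤ 1 / R * m :=
            mul_le_mul hRP (by linarith) (by positivity) hRpos.le
          calc η * (1 - 1 / P) / 3 * N = η * ((1 - 1 / P) * (N / 3)) := by ring
            _ ≤ η * (1 / R * m) := by gcongr
            _ = _ := by ring
    _ = ENNReal.ofReal ((C₁.toReal * t ^ (η * (1 - 1 / P) / 3)) ^ N) := by
        have ht0 : 0 ≤ t := ht.1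
        rw [ENNReal.ofReal_pow (by positivity), ENNReal.ofReal_mul ENNReal.toReal_nonneg,
          ENNReal.ofReal_toReal hC₁t, ← ENNReal.ofReal_rpow_of_nonneg ht.1 (by positivity),
          mul_pow, ENNReal.rpow_natCast, ENNReal.rpow_mul, ENNReal.rpow_natCast]
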